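/- **Setup.** Let $k$ be an arbitrary field. For a field $K\supseteq k$, let $S=K[x_0,\dots,x_r]$, and for a finite set $\Gamma\subset\mathbb P^r(K)$ let $I_\Gamma\subset S$ be its homogeneous ideal, generated by the forms vanishing on $\Gamma$. Let $\beta_{i,j}=\dim_K\operatorname{Tor}_i^S(S/I_\Gamma,K)_j$ be the graded Betti numbers of $S/I_\Gamma$, i.e. the number of generators of degree $j$ of the $i$-th free module in the minimal graded free resolution of $S/I_\Gamma$. Let $d$ be the least degree of a nonzero form in $I_\Gamma$, and define the integers $b_j$ by $\sum_n \dim_K (S/I_\Gamma)_n\,t^n=\big(\sum_j b_jt^j\big)/(1-t)^{r+1}$. The expected Betti numbers are $\tilde\beta_{0,0}=1$, $\tilde\beta_{i,j}=\max\big((-1)^i b_j,0\big)$ for $i\ge 1$ and $j\in\{i+d-1,\,i+d\}$, and $\tilde\beta_{i,j}=0$ otherwise; for a general set of points they are lower bounds for the $\beta_{i,j}$. The Minimal Resolution Conjecture (MRC) holds for $\Gamma$ if $\beta_{i,j}=\tilde\beta_{i,j}$ for all $i,j$. We say that the MRC fails for a general set of $\gamma$ points in $\mathbb P^r$ if there is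 a nonempty Zariski open subset of $(\mathbb P^r)^\gamma$, defined over $k$, such that for every extension field $K$ of $k$ the MRC does not hold for $\Gamma=\{p_1,\dots,p_\gamma\}$ whenever $(p_1,\dots,p_\gamma)$ is a $K$-point of this open subset. **Theorem.** The MRC fails for a general set of $\gamma$ points in $\mathbb P^r$ whenever $r\ge 6$, $r\ne 9$ and $$r+2+\sqrt{r+2}\;\le\;\gamma\;\le\; r+\frac{3+\sqrt{8r+1}}{2},$$ and also when $(r,\gamma)=(8,13)$ or $(r,\gamma)=(15,21)$. Moreover, for each $r\ge 6$, $r\neq 9$, the number $N(r)$ of integers $\gamma$ in the displayed range satisfies $\big|N(r)-(\sqrt2-1)\sqrt r\big|<2$. -/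

import Mathlib

open scoped LinearAlgebra.Projectivization

universe u

namespace PointsMRC

/-- The polynomial ring `S = K[x_0, …, x_r]`, the homogeneous coordinate ring of `ℙ^r`. -/
abbrev CoordRing (K : Type u) [Field K] (r : ℕ) : Type u := MvPolynomial (Fin (r + 1)) K

section Ideals

variable {K : Type u} [Field K] {r : ℕ}

/-- The homogeneous ideal of a family of points of `ℙ^r`: it is generated by the forms that
vanish at all of them. (Vanishing of a form does not depend on the representative. Only forms
are used, so that the definition is the correct one over finite fields as well.) -/
noncomputable def pointsIdeal {γ : ℕ} (p : Fin γ → ℙ K (Fin (r + 1) → K)) : Ideal (CoordRing K r) :=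
  Ideal.span {F | (∃ n, F.IsHomogeneous n) ∧ ∀ i, MvPolynomial.eval (p i).rep F = 0}

/-- The Hilbert function `n ↦ dim_K (S/I)_n`. -/
noncomputable def hilbertFn (I : Ideal (CoordRing K r)) (n : ℕ) : ℕ :=
  Module.finrank K
    ((MvPolynomial.homogeneousSubmodule (Fin (r + 1)) K n).map
      (Ideal.Quotient.mkₐ K I).toLinearMap)

/-- The integers `b_j` determined by `∑_n dim (S/I)_n t^n = (∑_j b_j t^j) / (1 - t)^(r+1)`. -/
noncomputable def hilbertNumerator (I : Ideal (CoordRing K r)) (j : ℕ) : ℤ :=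
  PowerSeries.coeff j
    ((PowerSeries.mk fun n => (hilbertFn I n : ℤ)) * (1 - PowerSeries.X) ^ (r + 1))

/-- The least degree of a nonzero form in `I`. -/
noncomputable def initialDegree (I : Ideal (CoordRing K r)) : ℕ :=
  sInf {n | ∃ F ∈ I, F ≠ 0 ∧ F.IsHomogeneous n}

/-- The expected graded Betti numbers of `S/I`, the lower bound that the Hilbert function gives
for the ideal `I` of a general set of points. With `d` the initial degree of such an ideal, the
Betti numbers `β_{i,j}` with `i ≥ 1` vanish unless `j = i + d - 1` or `j = i + d`. So at most two
of them, in consecutive homological degrees, contribute to `∑_i (-1)^i β_{i,j} = b_j`, and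
`β_{i,j} ≥ max ((-1)^i b_j, 0)` at these positions. -/
noncomputable def expectedBetti (I : Ideal (CoordRing K r)) (i j : ℕ) : ℤ :=
  if i = 0 then (if j = 0 then 1 else 0)
  else if j + 1 = i + initialDegree I ∨ j = i + initialDegree I then
    max ((-1) ^ i * hilbertNumerator I j) 0
  else 0

/-- A minimal graded free resolution
`⋯ → F_2 → F_1 → F_0 → S/I → 0`, where `F_i = ⨁_a S(-deg i a)` is free of rank `rank i` with
basis vectors of degrees `deg i a`, and the differentials are given by matrices. -/
structure MinimalFreeResolution (I : Ideal (CoordRing K r)) where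
  /-- the rank of `F_i` -/
  rank : ℕ → ℕ
  /-- the degrees of the basis vectors of `F_i` -/
  deg : ∀ i, Fin (rank i) → ℕ
  /-- the matrix of `F_{i+1} → F_i` -/
  d : ∀ i, Matrix (Fin (rank i)) (Fin (rank (i + 1))) (CoordRing K r)
  /-- the augmentation `F_0 → S/I` -/
  aug : (Fin (rank 0) → CoordRing K r) →ₗ[CoordRing K r] CoordRing K r ⧸ I
  /-- the differentials preserve degrees: the entry `(b, a)` is homogeneous of degree
  `deg (i+1) a - deg i b` (and zero if this is negative) -/
  d_homogeneous : ∀ i b a, ∀ m ∈ (d i b a).support, m.degree + deg i b = deg (i + 1) a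
  /-- the augmentation preserves degrees -/
  aug_homogeneous : ∀ a, ∃ F : CoordRing K r, F.IsHomogeneous (deg 0 a) ∧
    aug (Pi.single a 1) = Ideal.Quotient.mk I F
  aug_surjective : Function.Surjective aug
  exact_zero : Function.Exact (d 0).mulVecLin aug
  exact_succ : ∀ i, Function.Exact (d (i + 1)).mulVecLin (d i).mulVecLin
  /-- minimality: the entries of the differentials lie in the ideal `(x_0, …, x_r)` -/
  minimal : ∀ i b a, MvPolynomial.constantCoeff (d i b a) = 0

/-- The number of basis vectors of degree `j` in `F_i`; this is the graded Betti number
`β_{i,j} = dim_K Tor_i^S(S/I, K)_j`. -/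
def MinimalFreeResolution.betti {I : Ideal (CoordRing K r)} (F : MinimalFreeResolution I)
    (i j : ℕ) : ℕ :=
  Fintype.card {a : Fin (F.rank i) // F.deg i a = j}

/-- The conclusion of the Minimal Resolution Conjecture for a family of points: the graded Betti
numbers of `S/I`, read off the minimal graded free resolution, are the expected ones. -/
def SatisfiesMRC {γ : ℕ} (p : Fin γ → ℙ K (Fin (r + 1) → K)) : Prop :=
  ∃ F : MinimalFreeResolution (pointsIdeal p),
    ∀ i j, (F.betti i j : ℤ) = expectedBetti (pointsIdeal p) i j

end Ideals

/-- The property `P` holds for a general set of `γ` points of `ℙ^r` over `k`: there is a nonempty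
Zariski open set of `γ`-tuples of points, defined over `k` by the nonvanishing of a polynomial `f`
in the homogeneous coordinates, such that `P` holds for all tuples in it with coordinates in any
extension field of `k`. (Extension fields matter if `k` is finite, as the open set may then have
no points over `k`.) -/
def HoldsForGeneralPoints (k : Type u) [Field k] (r γ : ℕ)
    (P : ∀ (K : Type u) [Field K], (Fin γ → ℙ K (Fin (r + 1) → K)) → Prop) : Prop :=
  ∃ f : MvPolynomial (Fin γ × Fin (r + 1)) k, f ≠ 0 ∧
    ∀ (K : Type u) [Field K] [Algebra k K] (v : Fin γ → Fin (r + 1) → K) (hv : ∀ i, v i ≠ 0),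
      MvPolynomial.aeval (fun x : Fin γ × Fin (r + 1) => v x.1 x.2) f ≠ 0 →
        P K (fun i => Projectivization.mk K (v i) (hv i))

/-- The Minimal Resolution Conjecture fails for a general set of `γ` points of `ℙ^r` over `k`. -/
def MRCFails (k : Type u) [Field k] (r γ : ℕ) : Prop :=
  HoldsForGeneralPoints k r γ fun _ _ p => ¬ SatisfiesMRC p

end PointsMRC

/-!
Let the rows of `P` be the coordinates of `γ = r + s + 2` points of `ℙ^r` in linearly general
position, put `i = r - s`, and let `W` be the Gale transform of `P`, that is `γ` points of `ℙ^s`.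

The Koszul complex with values in `K^Γ`, on which the linear forms act through their values at the
points, is exact. Pushing cochains of degree `s` through the minimal resolution therefore embeds
into `Tor_i(S/I, K)_{i+2}` the space of alternating `s`-forms with values in `K^Γ`, modulo
coboundaries and modulo the forms all of whose values come from linear forms.

To bound this quotient from below, let `u` be a weight on the points with `∑ u_j q(w_j) = 0` for all
quadrics `q` on `ℙ^s`. Multiplication by `u` turns the relations `W c` among the points into values
of linear forms, since it makes them orthogonal to all relations. If `y + C(s + 2, 2) ≤ γ` there are
at least `y` independent such weights, and the functional they define is onto the polynomials of
degree `s` in `y` variables. Hence `β_{i,i+2}` is at least the number of monomials of degree `s` in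
`y` variables. For `y = 1` this already contradicts the conjecture when `s² ≥ r + 2`, because
`(-1)^i b_{i+2}` is a negative multiple of `s² - (r + 2)`, while `C(s + 2, 2) < γ` says that
`s (s + 1) ≤ 2 r`. The two further cases use `y = 3` and `y = 6`.
-/

namespace PointsMRC

open AlternatingMap (alternatizeUncurryFinLM alternatizeUncurryFin_apply
  alternatizeUncurryFin_alternatizeUncurryFinLM_comp_of_symmetric)

section Koszul

variable {R A B V W M N : Type*} [CommRing R] [CommRing A] [Algebra R A] [CommRing B] [Algebra R B]
  [AddCommGroup V] [Module R V] [AddCommGroup W] [Module R W]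
  [AddCommGroup M] [Module R M] [Module A M] [IsScalarTower R A M]
  [AddCommGroup N] [Module R N] [Module B N] [IsScalarTower R B N]

/-- The Koszul differential on the alternating maps with values in `M`, for the action of `V` on
the `A`-module `M` through `ℓ : V → A`. For `M = A` and `ℓ` the inclusion of the linear forms this
is the Koszul complex `Λ^q V* ⊗ A`. -/
def koszul (ℓ : V →ₗ[R] A) (q : ℕ) :
    (V [⋀^Fin q]→ₗ[R] M) →ₗ[R] (V [⋀^Fin (q + 1)]→ₗ[R] M) :=
  alternatizeUncurryFinLM ∘ₗ
    LinearMap.mk₂ R (fun φ v => (Algebra.lsmul R R M (ℓ v)).compAlternatingMap φ)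
      (fun _ _ _ => by ext; simp) (fun _ _ _ => by ext; simp)
      (fun _ _ _ => by ext; simp) (fun _ _ _ => by ext; simp)

theorem koszul_apply (ℓ : V →ₗ[R] A) (q : ℕ) (φ : V [⋀^Fin q]→ₗ[R] M) (v : Fin (q + 1) → V) :
    koszul ℓ q φ v = ∑ i : Fin (q + 1), (-1) ^ (i : ℕ) • ℓ (v i) • φ (i.removeNth v) := by
  simp [koszul, alternatizeUncurryFin_apply]

@[simp]
theorem koszul_koszul (ℓ : V →ₗ[R] A) (q : ℕ) (φ : V [⋀^Fin q]→ₗ[R] M) :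
    koszul ℓ (q + 1) (koszul ℓ q φ) = 0 := by
  have h := alternatizeUncurryFin_alternatizeUncurryFinLM_comp_of_symmetric
    (f := LinearMap.mk₂ R (fun v w => (Algebra.lsmul R R M (ℓ v * ℓ w)).compAlternatingMap φ)
      (fun _ _ _ => by ext; simp [add_mul]) (fun _ _ _ => by ext; simp)
      (fun _ _ _ => by ext; simp [mul_add]) (fun _ _ _ => by ext; simp))
    (fun v w => by rw [LinearMap.mk₂_apply, LinearMap.mk₂_apply, mul_comm])
  rw [← h]
  ext v
  simp [koszul_apply, alternatizeUncurryFin_apply, Finset.smul_sum,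
    smul_comm (ℓ _) ((-1 : ℤ) ^ _)]

theorem koszul_compAlternatingMap {ℓ : V →ₗ[R] A} {ℓ' : V →ₗ[R] B} (f : M →ₗ[R] N)
    (hf : ∀ v x, f (ℓ v • x) = ℓ' v • f x) (q : ℕ) (φ : V [⋀^Fin q]→ₗ[R] M) :
    koszul ℓ' q (f.compAlternatingMap φ) = f.compAlternatingMap (koszul ℓ q φ) := by
  ext v
  simp [koszul_apply, hf]

theorem koszul_compLinearMap (ℓ : V →ₗ[R] A) (f : W →ₗ[R] V) (q : ℕ) (φ : V [⋀^Fin q]→ₗ[R] M) :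
    koszul (ℓ ∘ₗ f) q (φ.compLinearMap f) = (koszul ℓ q φ).compLinearMap f := by
  ext v
  simp only [koszul_apply, AlternatingMap.compLinearMap_apply]
  rfl

theorem koszul_smul (a : R) (ℓ : V →ₗ[R] A) (q : ℕ) (φ : V [⋀^Fin q]→ₗ[R] M) :
    koszul (a • ℓ) q φ = a • koszul ℓ q φ := by
  ext v
  simp [koszul_apply, Finset.smul_sum, smul_comm a]

-- The contraction with `v` is a homotopy between multiplication by `ℓ v` and zero.
theorem koszul_curryLeft_add (ℓ : V →ₗ[R] A) (q : ℕ) (φ : V [⋀^Fin (q + 1)]→ₗ[R] M) (v : V) :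
    koszul ℓ q (φ.curryLeft v) + (koszul ℓ (q + 1) φ).curryLeft v
      = (Algebra.lsmul R R M (ℓ v)).compAlternatingMap φ := by
  ext m
  have removeNth_zero : (0 : Fin (q + 2)).removeNth (Matrix.vecCons v m) = m := by
    ext j; simp [Fin.removeNth]
  have removeNth_succ (i : Fin (q + 1)) :
      i.succ.removeNth (Matrix.vecCons v m) = Matrix.vecCons v (i.removeNth m) := by
    ext j
    refine Fin.cases ?_ (fun j => ?_) j <;> simp [Fin.removeNth]
  simp only [AlternatingMap.add_apply, koszul_apply, AlternatingMap.curryLeft_apply_apply,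
    LinearMap.compAlternatingMap_apply]
  rw [Fin.sum_univ_succ (n := q + 1)]
  simp [removeNth_zero, removeNth_succ, pow_succ]

theorem koszul_curryLeft_of_koszul_eq_zero {ℓ : V →ₗ[R] A} {q : ℕ}
    {φ : V [⋀^Fin (q + 1)]→ₗ[R] M} (hφ : koszul ℓ (q + 1) φ = 0) (v : V) :
    koszul ℓ q (φ.curryLeft v) = (Algebra.lsmul R R M (ℓ v)).compAlternatingMap φ := by
  rw [← koszul_curryLeft_add, hφ]
  ext
  simp

/-- The coboundaries of the Koszul complex. The complex starts in degree `0`, where they vanish. -/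
def koszulCoboundaries (ℓ : V →ₗ[R] A) (M : Type*) [AddCommGroup M] [Module R M] [Module A M]
    [IsScalarTower R A M] : ∀ q, Submodule R (V [⋀^Fin q]→ₗ[R] M)
  | 0 => ⊥
  | q + 1 => LinearMap.range (koszul ℓ q)

/-- The cohomology of the Koszul complex with values in `M` vanishes in the degrees below `D`. -/
def KoszulAcyclic (ℓ : V →ₗ[R] A) (M : Type*) [AddCommGroup M] [Module R M] [Module A M]
    [IsScalarTower R A M] (D : ℕ) : Prop :=
  ∀ q < D, ∀ φ : V [⋀^Fin q]→ₗ[R] M, koszul ℓ q φ = 0 → φ ∈ koszulCoboundaries ℓ M q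

theorem koszul_eq_zero_of_mem_koszulCoboundaries {ℓ : V →ₗ[R] A} {q : ℕ}
    {φ : V [⋀^Fin q]→ₗ[R] M} (hφ : φ ∈ koszulCoboundaries ℓ M q) : koszul ℓ q φ = 0 := by
  cases q with
  | zero => rw [(Submodule.mem_bot R).1 hφ, map_zero]
  | succ q =>
    obtain ⟨ψ, rfl⟩ := hφ
    exact koszul_koszul ℓ q ψ

theorem koszulAcyclic_of_apply_eq_one {ℓ : V →ₗ[R] A} {v : V} (hv : ℓ v = 1) (D : ℕ) :
    KoszulAcyclic ℓ M D := by
  rintro (_ | q) - φ hφ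
  · have := DFunLike.congr_fun hφ fun _ => v
    refine (Submodule.mem_bot R).2 (AlternatingMap.ext fun m => ?_)
    simpa [koszul_apply, hv, Subsingleton.elim m (Fin.removeNth 0 fun _ => v)] using this
  · refine ⟨φ.curryLeft v, ?_⟩
    rw [koszul_curryLeft_of_koszul_eq_zero hφ, hv]
    ext
    simp

theorem KoszulAcyclic.pi {ι : Type*} {C : ι → Type*} [∀ i, CommRing (C i)]
    [∀ i, Algebra R (C i)] {N : ι → Type*} [∀ i, AddCommGroup (N i)] [∀ i, Module R (N i)]
    [∀ i, Module (C i) (N i)] [∀ i, IsScalarTower R (C i) (N i)] [Module A (∀ i, N i)]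
    [IsScalarTower R A (∀ i, N i)] {ℓ : V →ₗ[R] A} {ℓ' : ∀ i, V →ₗ[R] C i} {D : ℕ}
    (hsmul : ∀ v (x : ∀ i, N i) i, (ℓ v • x) i = ℓ' i v • x i)
    (h : ∀ i, KoszulAcyclic (ℓ' i) (N i) D) : KoszulAcyclic ℓ (∀ i, N i) D := by
  intro q hq φ hφ
  have mem_coboundaries (i : ι) :
      (LinearMap.proj i).compAlternatingMap φ ∈ koszulCoboundaries (ℓ' i) (N i) q := by
    refine h i q hq _ ?_
    rw [koszul_compAlternatingMap (ℓ := ℓ) _ fun v x => hsmul v x i, hφ]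
    rfl
  cases q with
  | zero =>
    refine (Submodule.mem_bot R).2 (AlternatingMap.ext fun m => funext fun i => ?_)
    exact DFunLike.congr_fun ((Submodule.mem_bot R).1 (mem_coboundaries i)) m
  | succ q =>
    choose ψ hψ using mem_coboundaries
    refine ⟨AlternatingMap.pi ψ, AlternatingMap.ext fun m => funext fun i => ?_⟩
    have := koszul_compAlternatingMap (LinearMap.proj i) (fun v x => hsmul v x i) q
      (AlternatingMap.pi ψ)
    exact (DFunLike.congr_fun this m).symm.trans (DFunLike.congr_fun (hψ i) m)

end Koszul

section KoszulField

variable {K A B V M N : Type*} [Field K] [CommRing A] [Algebra K A] [CommRing B] [Algebra K B]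
  [AddCommGroup V] [Module K V]
  [AddCommGroup M] [Module K M] [Module A M] [IsScalarTower K A M]
  [AddCommGroup N] [Module K N] [Module B N] [IsScalarTower K B N]

theorem exists_rightInverse_on_range {M N : Type*} [AddCommGroup M] [Module K M]
    [AddCommGroup N] [Module K N] (f : M →ₗ[K] N) :
    ∃ g : N →ₗ[K] M, ∀ y ∈ LinearMap.range f, f (g y) = y := by
  obtain ⟨g, hg⟩ := f.rangeRestrict.exists_rightInverse_of_surjective f.range_rangeRestrict
  obtain ⟨g', rfl⟩ := LinearMap.exists_extend g
  exact ⟨g', fun y hy => congrArg Subtype.val (LinearMap.congr_fun hg ⟨y, hy⟩)⟩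

theorem exists_compAlternatingMap_eq {M N ι : Type*} [AddCommGroup M] [Module K M]
    [AddCommGroup N] [Module K N] (f : M →ₗ[K] N) (φ : V [⋀^ι]→ₗ[K] N)
    (hφ : ∀ v, φ v ∈ LinearMap.range f) : ∃ θ, f.compAlternatingMap θ = φ := by
  obtain ⟨g, hg⟩ := exists_rightInverse_on_range f
  exact ⟨g.compAlternatingMap φ, AlternatingMap.ext fun v => hg _ (hφ v)⟩

theorem exists_mem_koszulCoboundaries_lift {ℓ : V →ₗ[K] A} {ℓ' : V →ₗ[K] B} {f : M →ₗ[K] N}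
    (hf : ∀ v x, f (ℓ v • x) = ℓ' v • f x) (hsurj : Function.Surjective f) {q : ℕ}
    {ψ : V [⋀^Fin q]→ₗ[K] N} (hψ : ψ ∈ koszulCoboundaries ℓ' N q) :
    ∃ χ ∈ koszulCoboundaries ℓ M q, f.compAlternatingMap χ = ψ := by
  cases q with
  | zero => exact ⟨0, zero_mem _, by rw [(Submodule.mem_bot K).1 hψ]; ext; simp⟩
  | succ q =>
    obtain ⟨ψ, rfl⟩ := hψ
    obtain ⟨θ, rfl⟩ := exists_compAlternatingMap_eq f ψ fun v => hsurj (ψ v)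
    exact ⟨koszul ℓ q θ, ⟨θ, rfl⟩, (koszul_compAlternatingMap f hf q θ).symm⟩

theorem KoszulAcyclic.of_quotient {ℓ : V →ₗ[K] A} {ℓ' : V →ₗ[K] B} {f : M →ₗ[K] N}
    (hf : ∀ v x, f (ℓ v • x) = ℓ' v • f x) (hsurj : Function.Surjective f) {v : V}
    (hreg : IsSMulRegular M (ℓ v)) (hexact : Function.Exact (Algebra.lsmul K K M (ℓ v)) f) {D : ℕ}
    (h : KoszulAcyclic ℓ' N D) : KoszulAcyclic ℓ M (D + 1) := by
  rintro (_ | q) hq φ hφ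
  · refine (Submodule.mem_bot K).2 (AlternatingMap.ext fun m => hreg ?_)
    have := DFunLike.congr_fun hφ fun _ => v
    simpa [koszul_apply, Subsingleton.elim m (Fin.removeNth 0 fun _ => v)] using this
  have hcontract := koszul_curryLeft_of_koszul_eq_zero hφ v
  have hclosed : koszul ℓ' q (f.compAlternatingMap (φ.curryLeft v)) = 0 := by
    rw [koszul_compAlternatingMap f hf, hcontract]
    exact AlternatingMap.ext fun m => hexact.apply_apply_eq_zero (φ m)
  obtain ⟨χ, hχ, hfχ⟩ :=
    exists_mem_koszulCoboundaries_lift hf hsurj (h q (by lia) _ hclosed)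
  obtain ⟨θ, hθ⟩ := exists_compAlternatingMap_eq (Algebra.lsmul K K M (ℓ v))
    (φ.curryLeft v - χ) fun m => (hexact _).1 <| by
      rw [AlternatingMap.sub_apply, map_sub, sub_eq_zero]
      exact (DFunLike.congr_fun hfχ m).symm
  have hsmul : (Algebra.lsmul K K M (ℓ v)).compAlternatingMap (koszul ℓ q θ)
      = (Algebra.lsmul K K M (ℓ v)).compAlternatingMap φ := by
    rw [← koszul_compAlternatingMap (ℓ := ℓ) _ fun w x => smul_comm (ℓ v) (ℓ w) x, hθ, map_sub,
      hcontract, koszul_eq_zero_of_mem_koszulCoboundaries hχ, sub_zero]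
  exact ⟨θ, AlternatingMap.ext fun m => hreg (DFunLike.congr_fun hsmul m)⟩

end KoszulField

section LinearForms

variable {K : Type*} [Field K]

open MvPolynomial

/-- The linear form with given coefficients. -/
noncomputable def linForm (K : Type*) [Field K] (n : ℕ) :
    (Fin n → K) →ₗ[K] MvPolynomial (Fin n) K :=
  Fintype.linearCombination K X

theorem linForm_apply {n : ℕ} (v : Fin n → K) : linForm K n v = ∑ i, v i • X i := by
  simp [linForm, Fintype.linearCombination_apply]

@[simp]
theorem linForm_single {n : ℕ} (i : Fin n) : linForm K n (Pi.single i 1) = X i := by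
  simp [linForm]

theorem range_linForm (n : ℕ) :
    LinearMap.range (linForm K n) = homogeneousSubmodule (Fin n) K 1 := by
  rw [linForm, Fintype.range_linearCombination, homogeneousSubmodule_one_eq_span_X]

theorem isHomogeneous_linForm {n : ℕ} (v : Fin n → K) : (linForm K n v).IsHomogeneous 1 := by
  rw [← mem_homogeneousSubmodule, ← range_linForm]
  exact LinearMap.mem_range_self _ v

/-- The quotient map modulo the first variable. -/
noncomputable def modXZero (K : Type*) [Field K] (n : ℕ) :
    MvPolynomial (Fin (n + 1)) K →ₐ[K] MvPolynomial (Fin n) K :=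
  aeval (Fin.cases 0 X)

theorem modXZero_linForm {n : ℕ} (v : Fin (n + 1) → K) :
    modXZero K n (linForm K (n + 1) v) = linForm K n (v ∘ Fin.succ) := by
  simp [modXZero, linForm_apply, Fin.sum_univ_succ]

theorem modXZero_surjective (n : ℕ) : Function.Surjective (modXZero K n) := fun P =>
  ⟨rename Fin.succ P, by
    rw [modXZero, aeval_rename]
    exact aeval_X_left_apply P⟩

theorem modXZero_eq_zero_iff {n : ℕ} {P : MvPolynomial (Fin (n + 1)) K} :
    modXZero K n P = 0 ↔ X 0 ∣ P := by
  have modXZero_eq_coeff : modXZero K n P = (finSuccEquiv K n P).coeff 0 := by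
    have : modXZero K n =
        ((Polynomial.aeval (R := MvPolynomial (Fin n) K) 0).restrictScalars K).comp
          (finSuccEquiv K n).toAlgHom := by
      refine algHom_ext fun i => Fin.cases ?_ (fun i => ?_) i <;>
        simp [modXZero, finSuccEquiv_X_zero, finSuccEquiv_X_succ]
    simp [this, Polynomial.coeff_zero_eq_aeval_zero]
  rw [modXZero_eq_coeff, ← Polynomial.X_dvd_iff, ← finSuccEquiv_X_zero (R := K),
    map_dvd_iff]

theorem koszulAcyclic_mvPolynomial {V : Type*} [AddCommGroup V] [Module K V] {n : ℕ}
    {c : V →ₗ[K] (Fin n → K)} (hc : Function.Surjective c) :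
    KoszulAcyclic (linForm K n ∘ₗ c) (MvPolynomial (Fin n) K) n := by
  induction n with
  | zero => exact fun q hq => absurd hq q.not_lt_zero
  | succ n ih =>
    obtain ⟨v, hv⟩ := hc (Pi.single 0 1)
    have hℓv : (linForm K (n + 1) ∘ₗ c) v = X 0 := by simp [hv]
    refine (ih (c := LinearMap.funLeft K K Fin.succ ∘ₗ c) ?_).of_quotient
      (f := (modXZero K n).toLinearMap) (fun w P => ?_) (modXZero_surjective n) (v := v) ?_ ?_
    · exact (LinearMap.funLeft_surjective_of_injective K K _ (Fin.succ_injective n)).comp hc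
    · simp [modXZero_linForm, LinearMap.funLeft, Function.comp_def]
    · rw [hℓv]
      exact fun P Q h => mul_left_cancel₀ (X_ne_zero 0) h
    · rw [hℓv]
      exact fun P => modXZero_eq_zero_iff.trans ⟨fun ⟨Q, hQ⟩ => ⟨Q, hQ.symm⟩,
        fun ⟨Q, hQ⟩ => ⟨Q, hQ.symm⟩⟩

theorem koszulAcyclic_free (n : ℕ) (ρ : Type*) :
    KoszulAcyclic (linForm K n) (ρ → MvPolynomial (Fin n) K) n :=
  .pi (ℓ' := fun _ => linForm K n ∘ₗ LinearMap.id) (fun _ _ _ => rfl) fun _ =>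
    koszulAcyclic_mvPolynomial Function.surjective_id

end LinearForms

section Graded

variable {K σ ρ ρ' : Type*} [Field K]

open MvPolynomial

/-- The component of degree `j` of an element of `S(-c)`. It vanishes for `j < c`, where `j - c` is
a truncated subtraction. -/
noncomputable def twistedComponent (c j : ℕ) : MvPolynomial σ K →ₗ[K] MvPolynomial σ K :=
  if c ≤ j then homogeneousComponent (j - c) else 0

theorem coeff_twistedComponent (c j : ℕ) (m : σ →₀ ℕ) (P : MvPolynomial σ K) :
    coeff m (twistedComponent c j P) = if m.degree + c = j then coeff m P else 0 := by
  classical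
  unfold twistedComponent
  split_ifs with h h1 h1
  · rw [coeff_homogeneousComponent, if_pos (by lia)]
  · rw [coeff_homogeneousComponent, if_neg (by lia)]
  · lia
  · simp

theorem twistedComponent_twistedComponent (c j : ℕ) (P : MvPolynomial σ K) :
    twistedComponent c j (twistedComponent c j P) = twistedComponent c j P := by
  ext m
  simp only [coeff_twistedComponent]
  split_ifs <;> rfl

theorem twistedComponent_zero_left (j : ℕ) (P : MvPolynomial σ K) :
    twistedComponent 0 j P = homogeneousComponent j P := by
  simp [twistedComponent]

theorem twistedComponent_succ (c j : ℕ) (P : MvPolynomial σ K) :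
    twistedComponent (c + 1) (j + 1) P = twistedComponent c j P := by
  simp [twistedComponent]

theorem twistedComponent_mul {b a : ℕ} {G : MvPolynomial σ K}
    (hG : ∀ m ∈ G.support, m.degree + b = a) (j : ℕ) (P : MvPolynomial σ K) :
    twistedComponent b j (G * P) = G * twistedComponent a j P := by
  classical
  ext m
  have coeff_mul_coeff : ∀ x ∈ Finset.HasAntidiagonal.antidiagonal m,
      coeff x.1 G * coeff x.2 (twistedComponent a j P)
        = if m.degree + b = j then coeff x.1 G * coeff x.2 P else 0 := by
    intro x hx
    by_cases hx0 : coeff x.1 G = 0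
    · simp [hx0]
    have hdeg : m.degree = x.1.degree + x.2.degree := by
      rw [← Finset.HasAntidiagonal.mem_antidiagonal.1 hx, map_add]
    rw [coeff_twistedComponent, mul_ite, mul_zero]
    exact if_congr (by have := hG x.1 (mem_support_iff.2 hx0); lia) rfl rfl
  rw [coeff_twistedComponent, coeff_mul, coeff_mul, Finset.sum_congr rfl coeff_mul_coeff]
  split_ifs <;> simp

/-- The component of degree `j` of an element of the graded free module `⨁_a S(-deg a)`. -/
noncomputable def freeComponent (deg : ρ → ℕ) (j : ℕ) :
    (ρ → MvPolynomial σ K) →ₗ[K] (ρ → MvPolynomial σ K) :=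
  LinearMap.pi fun a => twistedComponent (deg a) j ∘ₗ LinearMap.proj a

theorem freeComponent_apply (deg : ρ → ℕ) (j : ℕ) (x : ρ → MvPolynomial σ K) (a : ρ) :
    freeComponent deg j x a = twistedComponent (deg a) j (x a) := rfl

theorem freeComponent_freeComponent (deg : ρ → ℕ) (j : ℕ) (x : ρ → MvPolynomial σ K) :
    freeComponent deg j (freeComponent deg j x) = freeComponent deg j x := by
  ext1 a
  simp only [freeComponent_apply, twistedComponent_twistedComponent]

theorem freeComponent_mulVec [Fintype ρ'] {deg : ρ → ℕ} {deg' : ρ' → ℕ}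
    {D : Matrix ρ ρ' (MvPolynomial σ K)}
    (hD : ∀ b a, ∀ m ∈ (D b a).support, m.degree + deg b = deg' a) (j : ℕ)
    (x : ρ' → MvPolynomial σ K) :
    freeComponent deg j (D.mulVec x) = D.mulVec (freeComponent deg' j x) := by
  ext1 b
  simp only [freeComponent_apply, Matrix.mulVec, dotProduct, map_sum]
  exact Finset.sum_congr rfl fun a _ => twistedComponent_mul (hD b a) j _

theorem homogeneousComponent_dotProduct [Fintype ρ] {deg : ρ → ℕ} {G : ρ → MvPolynomial σ K}
    (hG : ∀ a, (G a).IsHomogeneous (deg a)) (j : ℕ) (x : ρ → MvPolynomial σ K) :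
    homogeneousComponent j (G ⬝ᵥ x) = G ⬝ᵥ freeComponent deg j x := by
  simp only [← twistedComponent_zero_left, dotProduct, map_sum, freeComponent_apply]
  exact Finset.sum_congr rfl fun a _ =>
    twistedComponent_mul (fun m hm => ((hG a).degree_eq_sum_deg_support hm).symm) j _

theorem freeComponent_linForm_smul {n : ℕ} (deg : ρ → ℕ) (j : ℕ) (v : Fin n → K)
    (x : ρ → MvPolynomial (Fin n) K) :
    freeComponent deg (j + 1) (linForm K n v • x) = linForm K n v • freeComponent deg j x := by
  ext1 a
  simp only [freeComponent_apply, Pi.smul_apply, smul_eq_mul]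
  rw [twistedComponent_mul (a := deg a + 1), twistedComponent_succ]
  intro m hm
  have hdeg : m.degree = 1 := ((isHomogeneous_linForm v).degree_eq_sum_deg_support hm).symm
  rw [hdeg, add_comm]

theorem freeComponent_koszul {n : ℕ} (deg : ρ → ℕ) (j q : ℕ)
    (φ : (Fin n → K) [⋀^Fin q]→ₗ[K] (ρ → MvPolynomial (Fin n) K)) :
    (freeComponent deg (j + 1)).compAlternatingMap (koszul (linForm K n) q φ)
      = koszul (linForm K n) q ((freeComponent deg j).compAlternatingMap φ) := by
  ext1 v
  simp only [LinearMap.compAlternatingMap_apply, koszul_apply, map_sum, map_zsmul,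
    freeComponent_linForm_smul]

end Graded

section TopDegree

variable {K : Type*} [Field K] {n : ℕ} {ρ : Type*}

open MvPolynomial

theorem alternatingMap_sum_apply {R V N ι α : Type*} [CommRing R] [AddCommGroup V] [Module R V]
    [AddCommGroup N] [Module R N] (t : Finset α) (φ : α → V [⋀^ι]→ₗ[R] N) (v : ι → V) :
    (∑ i ∈ t, φ i) v = ∑ i ∈ t, φ i v :=
  map_sum (AddMonoidHom.mk' (fun ψ : V [⋀^ι]→ₗ[R] N => ψ v) fun _ _ => rfl) φ t

theorem exists_sum_X_smul_eq {x : ρ → MvPolynomial (Fin n) K}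
    (hx : ∀ a, constantCoeff (x a) = 0) :
    ∃ y : Fin n → ρ → MvPolynomial (Fin n) K, ∑ i, (X i : MvPolynomial (Fin n) K) • y i = x := by
  have mem_span (a : ρ) : x a ∈ Ideal.span (Set.range (X : Fin n → MvPolynomial (Fin n) K)) := by
    rw [← Set.image_univ, mem_ideal_span_X_image]
    intro m hm
    by_contra! h0
    have : m = 0 := by ext i; simpa using h0 i (Set.mem_univ _)
    subst this
    exact mem_support_iff.1 hm (hx a)
  choose y hy using fun a => Ideal.mem_span_range_iff_exists_fun.1 (mem_span a)
  refine ⟨fun i a => y a i, funext fun a => ?_⟩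
  simp [← hy a, Finset.sum_apply, mul_comm]

theorem mem_range_koszul_of_constantCoeff_eq_zero
    {φ : (Fin (n + 1) → K) [⋀^Fin (n + 1)]→ₗ[K] (ρ → MvPolynomial (Fin (n + 1)) K)}
    (hφ : ∀ a, constantCoeff (φ (Pi.basisFun K (Fin (n + 1))) a) = 0) :
    φ ∈ LinearMap.range (koszul (linForm K (n + 1)) n) := by
  obtain ⟨y, hy⟩ := exists_sum_X_smul_eq hφ
  let e := Pi.basisFun K (Fin (n + 1))
  let volume (x : ρ → MvPolynomial (Fin (n + 1)) K) :
      (Fin (n + 1) → K) [⋀^Fin (n + 1)]→ₗ[K] (ρ → MvPolynomial (Fin (n + 1)) K) :=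
    (LinearMap.toSpanSingleton K _ x).compAlternatingMap e.det
  have koszul_volume (i : Fin (n + 1)) :
      koszul (linForm K (n + 1)) n ((volume (y i)).curryLeft (Pi.single i 1))
        = (Algebra.lsmul K K _ (X i : MvPolynomial (Fin (n + 1)) K)).compAlternatingMap
          (volume (y i)) := by
    rw [← linForm_single]
    refine koszul_curryLeft_of_koszul_eq_zero (e.ext_alternating fun κ hκ => ?_) _
    exact absurd (Fintype.card_le_of_injective κ hκ) (by simp)
  refine ⟨∑ i, (volume (y i)).curryLeft (Pi.single i 1), ?_⟩
  rw [map_sum, Finset.sum_congr rfl fun i _ => koszul_volume i]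
  refine e.ext_alternating fun κ hκ => ?_
  obtain ⟨τ, rfl⟩ : ∃ τ : Equiv.Perm (Fin (n + 1)), ⇑τ = κ :=
    ⟨Equiv.ofBijective κ (Finite.injective_iff_bijective.1 hκ), rfl⟩
  have map_basis (ψ : (Fin (n + 1) → K) [⋀^Fin (n + 1)]→ₗ[K]
      (ρ → MvPolynomial (Fin (n + 1)) K)) : ψ (fun i => e (τ i)) = τ.sign • ψ e := ψ.map_perm e τ
  rw [map_basis, map_basis, ← hy]
  simp [alternatingMap_sum_apply, volume, e.det_self]

theorem finrank_le_card_of_koszul_injective [Fintype ρ] {T : Type*} [AddCommGroup T] [Module K T]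
    {deg : ρ → ℕ} {j : ℕ}
    (φ : T →ₗ[K] ((Fin (n + 1) → K) [⋀^Fin (n + 1)]→ₗ[K] (ρ → MvPolynomial (Fin (n + 1)) K)))
    (hdeg : ∀ t v, freeComponent deg j (φ t v) = φ t v)
    (hφ : ∀ t, φ t ∈ LinearMap.range (koszul (linForm K (n + 1)) n) → t = 0) :
    Module.finrank K T ≤ Fintype.card {a // deg a = j} := by
  let e := Pi.basisFun K (Fin (n + 1))
  let Φ : T →ₗ[K] ({a // deg a = j} → K) :=
    { toFun := fun t a => constantCoeff (φ t e a)
      map_add' := fun x y => by ext a; simp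
      map_smul' := fun c x => by ext a; simp }
  have hΦ : Function.Injective Φ := by
    refine (injective_iff_map_eq_zero Φ).2 fun t ht => hφ t ?_
    refine mem_range_koszul_of_constantCoeff_eq_zero fun a => ?_
    by_cases ha : deg a = j
    · exact congrFun ht ⟨a, ha⟩
    · rw [← hdeg, freeComponent_apply, constantCoeff_eq, coeff_twistedComponent,
        if_neg (by simpa using ha)]
  simpa using LinearMap.finrank_le_finrank_of_injective hΦ

end TopDegree

section DimensionShifting

variable {K B M T ρ ρ' : Type*} [Field K] [CommRing B] [Algebra K B] [AddCommGroup M] [Module K M]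
  [Module B M] [IsScalarTower K B M] [AddCommGroup T] [Module K T] [Fintype ρ'] {n : ℕ}

open MvPolynomial

/-- Each `φ t` is a cochain with values in `M` that becomes a cocycle of degree `j` modulo the
image of `f`, and the classes of the `φ t` in the degree `j` part of the `q`-th Koszul cohomology
of the cokernel of `f` depend injectively on `t`. -/
structure InjectsIntoCokernel (ℓ : (Fin n → K) →ₗ[K] B) (f : (ρ → MvPolynomial (Fin n) K) →ₗ[K] M)
    (deg : ρ → ℕ) (j : ℕ) {q : ℕ} (φ : T →ₗ[K] ((Fin n → K) [⋀^Fin q]→ₗ[K] M)) : Prop where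
  koszul_mem : ∀ t v, ∃ x, f (freeComponent deg (j + 1) x) = koszul ℓ q (φ t) v
  eq_zero : ∀ t, ∀ a ∈ koszulCoboundaries ℓ M q,
    ∀ b : (Fin n → K) [⋀^Fin q]→ₗ[K] (ρ → MvPolynomial (Fin n) K),
      φ t = a + (f ∘ₗ freeComponent deg j).compAlternatingMap b → t = 0

/-- The map of free modules given by a matrix of polynomials, as a linear map over the field. -/
noncomputable def freeMap (D : Matrix ρ ρ' (MvPolynomial (Fin n) K)) :
    (ρ' → MvPolynomial (Fin n) K) →ₗ[K] (ρ → MvPolynomial (Fin n) K) :=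
  D.mulVecLin.restrictScalars K

theorem freeMap_apply (D : Matrix ρ ρ' (MvPolynomial (Fin n) K)) (x) :
    freeMap D x = D.mulVec x := rfl

theorem freeMap_smul (D : Matrix ρ ρ' (MvPolynomial (Fin n) K)) (P : MvPolynomial (Fin n) K) (x) :
    freeMap D (P • x) = P • freeMap D x :=
  D.mulVecLin.map_smul P x

theorem InjectsIntoCokernel.exists_connecting {ℓ : (Fin n → K) →ₗ[K] B}
    {f : (ρ → MvPolynomial (Fin n) K) →ₗ[K] M} {deg : ρ → ℕ} {j q : ℕ}
    {φ : T →ₗ[K] ((Fin n → K) [⋀^Fin q]→ₗ[K] M)} (h : InjectsIntoCokernel ℓ f deg j φ) :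
    ∃ w : T →ₗ[K] ((Fin n → K) [⋀^Fin (q + 1)]→ₗ[K] (ρ → MvPolynomial (Fin n) K)),
      (∀ t v, freeComponent deg (j + 1) (w t v) = w t v) ∧
        ∀ t, f.compAlternatingMap (w t) = koszul ℓ q (φ t) := by
  obtain ⟨g, hg⟩ := exists_rightInverse_on_range (f ∘ₗ freeComponent deg (j + 1))
  exact ⟨LinearMap.compAlternatingMapₗ K (freeComponent deg (j + 1) ∘ₗ g) ∘ₗ koszul ℓ q ∘ₗ φ,
    fun t v => freeComponent_freeComponent _ _ _,
    fun t => AlternatingMap.ext fun v => hg _ (h.koszul_mem t v)⟩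

theorem InjectsIntoCokernel.shift {ℓ : (Fin n → K) →ₗ[K] B}
    {f : (ρ → MvPolynomial (Fin n) K) →ₗ[K] M} {deg : ρ → ℕ} {j q : ℕ}
    {φ : T →ₗ[K] ((Fin n → K) [⋀^Fin q]→ₗ[K] M)} (h : InjectsIntoCokernel ℓ f deg j φ)
    (hf : ∀ v x, f (linForm K n v • x) = ℓ v • f x)
    (hM : ∀ ψ : (Fin n → K) [⋀^Fin q]→ₗ[K] M, koszul ℓ q ψ = 0 → ψ ∈ koszulCoboundaries ℓ M q)
    {D : Matrix ρ ρ' (MvPolynomial (Fin n) K)} {deg' : ρ' → ℕ}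
    (hD : ∀ b a, ∀ m ∈ (D b a).support, m.degree + deg b = deg' a)
    (hzero : ∀ x, f (freeMap D x) = 0)
    (hexact : ∀ m x, f (freeComponent deg m x) = 0 → ∃ y, freeMap D y = freeComponent deg m x) :
    ∃ w : T →ₗ[K] ((Fin n → K) [⋀^Fin (q + 1)]→ₗ[K] (ρ → MvPolynomial (Fin n) K)),
      (∀ t v, freeComponent deg (j + 1) (w t v) = w t v) ∧
        InjectsIntoCokernel (linForm K n) (freeMap D) deg' (j + 1) w := by
  obtain ⟨w, hdeg, hw⟩ := h.exists_connecting
  have hcomp (t) : (freeComponent deg (j + 1)).compAlternatingMap (w t) = w t :=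
    AlternatingMap.ext (hdeg t)
  refine ⟨w, hdeg, fun t v => ?_, fun t a ha b hab => ?_⟩
  · have hcycle : f (koszul (linForm K n) (q + 1) (w t) v) = 0 := by
      have := koszul_compAlternatingMap f hf (q + 1) (w t)
      rw [hw, koszul_koszul] at this
      exact (DFunLike.congr_fun this v).symm
    have hhomogeneous : freeComponent deg (j + 1 + 1) (koszul (linForm K n) (q + 1) (w t) v)
        = koszul (linForm K n) (q + 1) (w t) v := by
      rw [← LinearMap.compAlternatingMap_apply, freeComponent_koszul, hcomp]
    obtain ⟨x, hx⟩ := hexact _ _ (hhomogeneous.symm ▸ hcycle)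
    refine ⟨x, ?_⟩
    rw [freeMap_apply, ← freeComponent_mulVec hD, ← freeMap_apply, hx,
      freeComponent_freeComponent, hhomogeneous]
  · obtain ⟨c, rfl⟩ := ha
    have hwt : w t = koszul (linForm K n) q ((freeComponent deg j).compAlternatingMap c)
        + (freeMap D ∘ₗ freeComponent deg' (j + 1)).compAlternatingMap b := by
      rw [← freeComponent_koszul, ← hcomp, hab, LinearMap.compAlternatingMap_add]
      congr 1
      ext1 v
      change freeComponent deg (j + 1) (D.mulVec _) = D.mulVec _
      rw [freeComponent_mulVec hD, freeComponent_freeComponent]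
    have hkoszul : koszul ℓ q (φ t)
        = koszul ℓ q ((f ∘ₗ freeComponent deg j).compAlternatingMap c) := by
      rw [← hw, hwt, LinearMap.compAlternatingMap_add, ← koszul_compAlternatingMap f hf]
      refine add_eq_left.2 (AlternatingMap.ext fun v => hzero _)
    refine h.eq_zero t _ (hM (φ t - (f ∘ₗ freeComponent deg j).compAlternatingMap c) ?_) c ?_
    · rw [map_sub, hkoszul, sub_self]
    · rw [sub_add_cancel]

end DimensionShifting

section Betti

variable {K : Type u} [Field K] {r : ℕ} {I : Ideal (CoordRing K r)}

open MvPolynomial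

theorem exists_aug_eq_mk_dotProduct (F : MinimalFreeResolution I) :
    ∃ G : Fin (F.rank 0) → CoordRing K r, (∀ a, (G a).IsHomogeneous (F.deg 0 a)) ∧
      ∀ x, F.aug x = Ideal.Quotient.mk I (G ⬝ᵥ x) := by
  choose G hG haug using F.aug_homogeneous
  refine ⟨G, hG, fun x => ?_⟩
  conv_lhs => rw [← Finset.univ_sum_single x, map_sum]
  rw [dotProduct, map_sum]
  refine Finset.sum_congr rfl fun a _ => ?_
  have hsingle : Pi.single a (x a) = x a • (Pi.single a 1 : Fin (F.rank 0) → CoordRing K r) := by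
    rw [← Pi.single_smul, smul_eq_mul, mul_one]
  rw [hsingle, map_smul, haug, mul_comm]
  rfl

variable {B M T : Type*} [CommRing B] [Algebra K B] [AddCommGroup M] [Module K M] [Module B M]
  [IsScalarTower K B M] [AddCommGroup T] [Module K T] {ℓ : (Fin (r + 1) → K) →ₗ[K] B}

theorem exists_injectsIntoCokernel_d (F : MinimalFreeResolution I)
    {f : (Fin (F.rank 0) → CoordRing K r) →ₗ[K] M}
    (hf : ∀ v x, f (linForm K (r + 1) v • x) = ℓ v • f x)
    (hzero : ∀ x, f (freeMap (F.d 0) x) = 0)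
    (hexact : ∀ m x, f (freeComponent (F.deg 0) m x) = 0 →
      ∃ y, freeMap (F.d 0) y = freeComponent (F.deg 0) m x)
    {j q : ℕ} (hM : ∀ ψ : (Fin (r + 1) → K) [⋀^Fin q]→ₗ[K] M, koszul ℓ q ψ = 0 →
      ψ ∈ koszulCoboundaries ℓ M q)
    {φ : T →ₗ[K] ((Fin (r + 1) → K) [⋀^Fin q]→ₗ[K] M)}
    (h : InjectsIntoCokernel ℓ f (F.deg 0) j φ) (p : ℕ) (hp : q + p ≤ r) :
    ∃ w : T →ₗ[K] ((Fin (r + 1) → K) [⋀^Fin (q + p + 1)]→ₗ[K] (Fin (F.rank p) → CoordRing K r)),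
      (∀ t v, freeComponent (F.deg p) (j + p + 1) (w t v) = w t v) ∧
        InjectsIntoCokernel (linForm K (r + 1)) (freeMap (F.d p)) (F.deg (p + 1)) (j + p + 1)
          w := by
  induction p with
  | zero => exact h.shift hf hM (F.d_homogeneous 0) hzero hexact
  | succ p ih =>
    obtain ⟨w, -, hw⟩ := ih (by lia)
    exact hw.shift (fun v x => freeMap_smul (F.d p) _ x) (koszulAcyclic_free (r + 1) _ _ (by lia))
      (F.d_homogeneous (p + 1)) (F.exact_succ p).apply_apply_eq_zero
      fun _ _ => (F.exact_succ p _).1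

theorem finrank_le_betti_of_injectsIntoCokernel (F : MinimalFreeResolution I)
    {f : (Fin (F.rank 0) → CoordRing K r) →ₗ[K] M}
    (hf : ∀ v x, f (linForm K (r + 1) v • x) = ℓ v • f x)
    (hzero : ∀ x, f (freeMap (F.d 0) x) = 0)
    (hexact : ∀ m x, f (freeComponent (F.deg 0) m x) = 0 →
      ∃ y, freeMap (F.d 0) y = freeComponent (F.deg 0) m x)
    {i j q : ℕ} (hqi : q + i = r)
    (hM : ∀ ψ : (Fin (r + 1) → K) [⋀^Fin q]→ₗ[K] M, koszul ℓ q ψ = 0 →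
      ψ ∈ koszulCoboundaries ℓ M q)
    {φ : T →ₗ[K] ((Fin (r + 1) → K) [⋀^Fin q]→ₗ[K] M)}
    (h : InjectsIntoCokernel ℓ f (F.deg 0) j φ) :
    Module.finrank K T ≤ F.betti i (j + i + 1) := by
  obtain ⟨w, hdeg, hw⟩ := exists_injectsIntoCokernel_d F hf hzero hexact hM h i hqi.le
  subst hqi
  refine finrank_le_card_of_koszul_injective w hdeg fun t ht => hw.eq_zero t _ ht 0 ?_
  ext1 v
  simp

theorem finrank_le_betti (F : MinimalFreeResolution I) {ε : CoordRing K r →ₗ[K] M}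
    (hε : ∀ P ∈ I, ε P = 0) (hε' : ∀ m P, P.IsHomogeneous m → ε P = 0 → P ∈ I)
    (hI : ∀ P ∈ I, ∀ j, homogeneousComponent j P ∈ I)
    (hεℓ : ∀ v P, ε (linForm K (r + 1) v * P) = ℓ v • ε P) {i j q : ℕ} (hqi : q + i = r)
    (hM : ∀ ψ : (Fin (r + 1) → K) [⋀^Fin q]→ₗ[K] M, koszul ℓ q ψ = 0 →
      ψ ∈ koszulCoboundaries ℓ M q)
    (φ : T →ₗ[K] ((Fin (r + 1) → K) [⋀^Fin q]→ₗ[K] M))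
    (koszul_mem : ∀ t v, ∃ P, P.IsHomogeneous (j + 1) ∧ ε P = koszul ℓ q (φ t) v)
    (eq_zero : ∀ t, ∀ a ∈ koszulCoboundaries ℓ M q,
      ∀ b : (Fin (r + 1) → K) [⋀^Fin q]→ₗ[K] CoordRing K r, (∀ v, (b v).IsHomogeneous j) →
        φ t = a + ε.compAlternatingMap b → t = 0) :
    Module.finrank K T ≤ F.betti i (j + i + 1) := by
  obtain ⟨G, hG, haug⟩ := exists_aug_eq_mk_dotProduct F
  let dotG : (Fin (F.rank 0) → CoordRing K r) →ₗ[K] CoordRing K r :=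
    dotProductBilin (CoordRing K r) K G
  have hmem (x) : dotG x ∈ I ↔ ∃ y, freeMap (F.d 0) y = x :=
    (Ideal.Quotient.eq_zero_iff_mem.symm.trans (by rw [haug]; rfl)).trans (F.exact_zero x)
  have hdotG (m x) : (dotG (freeComponent (F.deg 0) m x)).IsHomogeneous m := by
    change (G ⬝ᵥ freeComponent (F.deg 0) m x).IsHomogeneous m
    rw [← homogeneousComponent_dotProduct hG]
    exact homogeneousComponent_isHomogeneous m _
  refine finrank_le_betti_of_injectsIntoCokernel F (f := ε ∘ₗ dotG) (fun v x => ?_)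
    (fun x => hε _ ((hmem _).2 ⟨x, rfl⟩)) (fun m x hx => (hmem _).1 (hε' m _ (hdotG m x) hx))
    hqi hM (φ := φ) ⟨fun t v => ?_, fun t a ha b hab => ?_⟩
  · exact (congrArg ε (dotProduct_smul _ G x)).trans (hεℓ v _)
  · obtain ⟨P, hP, hPφ⟩ := koszul_mem t v
    obtain ⟨x, hx⟩ := F.aug_surjective (Ideal.Quotient.mk I P)
    rw [haug, Ideal.Quotient.eq] at hx
    have hcomponent := hI _ hx (j + 1)
    rw [map_sub, homogeneousComponent_dotProduct hG, homogeneousComponent_of_mem hP,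
      if_pos rfl] at hcomponent
    have hεcomponent := hε _ hcomponent
    rw [map_sub, sub_eq_zero] at hεcomponent
    exact ⟨x, hεcomponent.trans hPφ⟩
  · exact eq_zero t a ha ((dotG ∘ₗ freeComponent (F.deg 0) j).compAlternatingMap b)
      (fun v => hdotG j _) hab

end Betti

section GeneralPosition

open Matrix

variable {K Γ : Type*} [Field K] {n m : ℕ}

/-- Any `n` of the vectors in `K^n` that form the rows of the matrix are linearly independent. -/
def LinearlyGeneral (P : Matrix Γ (Fin n) K) : Prop :=
  ∀ ι : Fin n ↪ Γ, (P.submatrix ι id).det ≠ 0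

theorem exists_matrix_range_mulVecLin_le {U : Submodule K (Γ → K)} (hm : m ≤ Module.finrank K U) :
    ∃ W : Matrix Γ (Fin m) K, Function.Injective W.mulVec ∧ LinearMap.range W.mulVecLin ≤ U := by
  classical
  obtain ⟨u, hu⟩ := exists_linearIndependent_of_le_finrank hm
  refine ⟨(of fun l => (u l : Γ → K))ᵀ, ?_, ?_⟩
  · rw [mulVec_injective_iff]
    exact hu.map' U.subtype U.ker_subtype
  · rw [range_mulVecLin, Submodule.span_le]
    rintro _ ⟨l, rfl⟩
    exact (u l).2

variable [Fintype Γ]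

theorem exists_embedding_subset_range {J : Finset Γ} (hJ : J.card ≤ n)
    (hn : n ≤ Fintype.card Γ) : ∃ ι : Fin n ↪ Γ, ∀ j ∈ J, j ∈ Set.range ι := by
  obtain ⟨J', hJJ', hcard⟩ := Finset.exists_superset_card_eq hJ hn
  let e := (Finset.equivFinOfCardEq hcard).symm
  exact ⟨e.toEmbedding.trans (Function.Embedding.subtype _), fun j hj =>
    ⟨e.symm ⟨j, hJJ' hj⟩, congrArg Subtype.val (e.apply_symm_apply ⟨j, hJJ' hj⟩)⟩⟩

theorem LinearlyGeneral.mulVec_injective {P : Matrix Γ (Fin n) K} (hP : LinearlyGeneral P)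
    (hn : n ≤ Fintype.card Γ) : Function.Injective P.mulVec := by
  obtain ⟨ι, -⟩ := exists_embedding_subset_range (J := (∅ : Finset Γ)) (Nat.zero_le n) hn
  have hι := mulVec_injective_of_isUnit ((isUnit_iff_isUnit_det _).2 (hP ι).isUnit)
  exact fun x x' h => hι (funext fun i => congrFun h (ι i))

theorem LinearlyGeneral.eq_zero_of_vecMul_eq_zero {P : Matrix Γ (Fin n) K} (hP : LinearlyGeneral P)
    (hn : n ≤ Fintype.card Γ) {w : Γ → K} (hw : w ᵥ* P = 0) {J : Finset Γ} (hJ : J.card ≤ n)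
    (hwJ : ∀ j ∉ J, w j = 0) : w = 0 := by
  obtain ⟨ι, hι⟩ := exists_embedding_subset_range hJ hn
  have hsupport (j) (hj : j ∉ Set.range ι) : w j = 0 := hwJ j fun hjJ => hj (hι j hjJ)
  have hwι : (w ∘ ι) ᵥ* P.submatrix ι id = 0 := by
    rw [← hw]
    funext i
    exact Fintype.sum_of_injective ι ι.injective _ _
      (fun j hj => by rw [hsupport j hj, zero_mul]) fun _ => rfl
  have hzero := Matrix.eq_zero_of_vecMul_eq_zero (hP ι) hwι
  funext j
  by_cases hj : j ∈ Set.range ι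
  · obtain ⟨i, rfl⟩ := hj
    exact congrFun hzero i
  · exact hsupport j hj

theorem LinearlyGeneral.exists_mulVec_eq {W : Matrix Γ (Fin m) K} (hW : LinearlyGeneral W)
    (hm : m ≤ Fintype.card Γ) {J : Finset Γ} (hJ : J.card ≤ m) (z : Γ → K) :
    ∃ c, ∀ j ∈ J, (W *ᵥ c) j = z j := by
  obtain ⟨ι, hι⟩ := exists_embedding_subset_range hJ hm
  obtain ⟨c, hc⟩ := mulVec_surjective_iff_isUnit.2
    ((isUnit_iff_isUnit_det _).2 (hW ι).isUnit) (z ∘ ι)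
  refine ⟨c, fun j hj => ?_⟩
  obtain ⟨i, rfl⟩ := hι j hj
  exact congrFun hc i

/-- The rows of `W` are a Gale transform of the rows of `P`: the columns of `W` form a basis of the
space of linear relations between the rows of `P`. -/
structure IsGaleTransform (P : Matrix Γ (Fin n) K) (W : Matrix Γ (Fin m) K) : Prop where
  injective : Function.Injective W.mulVec
  exact : Function.Exact W.mulVecLin P.vecMulLinear

theorem LinearlyGeneral.exists_isGaleTransform {P : Matrix Γ (Fin n) K} (hP : LinearlyGeneral P)
    (hΓ : Fintype.card Γ = n + m) : ∃ W : Matrix Γ (Fin m) K, IsGaleTransform P W := by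
  have hrank : P.rank = n := by
    rw [rank, LinearMap.finrank_range_of_inj (hP.mulVec_injective (by lia)),
      Module.finrank_fin_fun]
  have hker : Module.finrank K (LinearMap.ker P.vecMulLinear) = m := by
    have := P.vecMulLinear.finrank_range_add_finrank_ker
    rw [← mulVecLin_transpose] at this ⊢
    rw [← rank, rank_transpose, hrank, Module.finrank_fintype_fun_eq_card] at this
    lia
  obtain ⟨W, hW, hrange⟩ := exists_matrix_range_mulVecLin_le hker.ge
  refine ⟨W, hW, LinearMap.exact_iff.2 (Submodule.eq_of_le_of_finrank_eq hrange ?_).symm⟩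
  rw [hker, LinearMap.finrank_range_of_inj hW, Module.finrank_fin_fun]

theorem IsGaleTransform.linearlyGeneral {P : Matrix Γ (Fin n) K} {W : Matrix Γ (Fin m) K}
    (hPW : IsGaleTransform P W) (hP : LinearlyGeneral P) (hΓ : Fintype.card Γ = n + m) :
    LinearlyGeneral W := by
  classical
  intro ι hdet
  obtain ⟨c, hc, hWc⟩ := exists_mulVec_eq_zero_iff.2 hdet
  refine hc (hPW.injective ?_)
  rw [mulVec_zero]
  refine hP.eq_zero_of_vecMul_eq_zero (by lia) (hPW.exact.apply_apply_eq_zero c)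
    (J := (Finset.univ.map ι)ᶜ) ?_ fun j hj => ?_
  · rw [Finset.card_compl, Finset.card_map, Finset.card_univ, Fintype.card_fin]
    lia
  · obtain ⟨i, -, rfl⟩ := Finset.mem_map.1 (Finset.notMem_compl.1 hj)
    exact congrFun hWc i

theorem IsGaleTransform.exact_mulVecLin_vecMulLinear {P : Matrix Γ (Fin n) K}
    {W : Matrix Γ (Fin m) K} (hPW : IsGaleTransform P W) :
    Function.Exact P.mulVecLin W.vecMulLinear := by
  have hrank : P.rank + W.rank = Fintype.card Γ := by
    have := P.vecMulLinear.finrank_range_add_finrank_ker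
    rwa [LinearMap.exact_iff.1 hPW.exact, ← mulVecLin_transpose, ← rank, rank_transpose, ← rank,
      Module.finrank_fintype_fun_eq_card] at this
  have horth (x c) : (P *ᵥ x) ⬝ᵥ (W *ᵥ c) = 0 := by
    rw [dotProduct_comm, dotProduct_mulVec]
    have : (W *ᵥ c) ᵥ* P = 0 := hPW.exact.apply_apply_eq_zero c
    rw [this, zero_dotProduct]
  have hle : LinearMap.range P.mulVecLin ≤ LinearMap.ker W.vecMulLinear := by
    rintro _ ⟨x, rfl⟩
    classical
    refine dotProduct_eq_zero _ fun c => ?_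
    exact (dotProduct_mulVec _ W c).symm.trans (horth x c)
  refine LinearMap.exact_iff.2 (Submodule.eq_of_le_of_finrank_eq hle ?_).symm
  have := W.vecMulLinear.finrank_range_add_finrank_ker
  rw [← mulVecLin_transpose] at this ⊢
  rw [← rank, rank_transpose, Module.finrank_fintype_fun_eq_card, ← hrank] at this
  exact (Nat.add_left_cancel ((add_comm _ _).trans this.symm).symm).symm

/-- The image of the rows of `W` under the quadratic Veronese map. -/
def veroneseMatrix (W : Matrix Γ (Fin m) K) : Matrix Γ (Sym2 (Fin m)) K :=
  of fun j z => (z.map (W j)).mul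

theorem exists_matrix_mulVec_mem_ker_veroneseMatrix (W : Matrix Γ (Fin m) K) {y : ℕ}
    (hy : y + (m + 1).choose 2 ≤ Fintype.card Γ) :
    ∃ Y : Matrix Γ (Fin y) K, Function.Injective Y.mulVec ∧
      ∀ v, (Y *ᵥ v) ᵥ* veroneseMatrix W = 0 := by
  have h := (veroneseMatrix W).vecMulLinear.finrank_range_add_finrank_ker
  have hrange := Submodule.finrank_le (LinearMap.range (veroneseMatrix W).vecMulLinear)
  rw [Module.finrank_fintype_fun_eq_card] at h hrange
  rw [Sym2.card, Fintype.card_fin] at hrange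
  obtain ⟨Y, hY, hYker⟩ := exists_matrix_range_mulVecLin_le (m := y)
    (U := LinearMap.ker (veroneseMatrix W).vecMulLinear) (by lia)
  exact ⟨Y, hY, fun v => hYker ⟨v, rfl⟩⟩

theorem sum_mul_mulVec_mul_mulVec {W : Matrix Γ (Fin m) K} {u : Γ → K}
    (hu : u ᵥ* veroneseMatrix W = 0) (c c' : Fin m → K) :
    ∑ j, u j * (W *ᵥ c) j * (W *ᵥ c') j = 0 := by
  classical
  have hzero : Wᵀ * diagonal u * W = 0 := by
    ext l l'
    rw [mul_apply]
    simpa [veroneseMatrix, vecMul, dotProduct, mul_assoc, mul_left_comm] using congrFun hu s(l, l')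
  calc ∑ j, u j * (W *ᵥ c) j * (W *ᵥ c') j
      = (W *ᵥ c) ⬝ᵥ diagonal u *ᵥ W *ᵥ c' := by
        simp only [dotProduct, mulVec_diagonal, mul_left_comm, mul_assoc]
    _ = c ⬝ᵥ (Wᵀ * diagonal u * W) *ᵥ c' := by
        rw [← vecMul_transpose, ← dotProduct_mulVec, mulVec_mulVec, mulVec_mulVec]
    _ = 0 := by rw [hzero, zero_mulVec, dotProduct_zero]

theorem LinearlyGeneral.eq_zero_of_vecMul_veroneseMatrix {W : Matrix Γ (Fin m) K}
    (hW : LinearlyGeneral W) (hm : m ≤ Fintype.card Γ) {u : Γ → K}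
    (hu : u ᵥ* veroneseMatrix W = 0) {J : Finset Γ} (hJ : J.card ≤ m) (huJ : ∀ j ∉ J, u j = 0) :
    u = 0 := by
  classical
  funext j
  by_cases hj : j ∈ J
  · obtain ⟨c, hc⟩ := hW.exists_mulVec_eq hm hJ (Pi.single j 1)
    have hsum := sum_mul_mulVec_mul_mulVec hu c c
    rw [Finset.sum_eq_single j (fun i _ hij => ?_) (by simp)] at hsum
    · simpa [hc j hj] using hsum
    · by_cases hi : i ∈ J
      · rw [hc i hi, Pi.single_eq_of_ne hij, mul_zero]
      · rw [huJ i hi, zero_mul, zero_mul]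
  · exact huJ j hj

theorem IsGaleTransform.exists_mulVec_eq_mul {P : Matrix Γ (Fin n) K} {W : Matrix Γ (Fin m) K}
    (hPW : IsGaleTransform P W) {u : Γ → K} (hu : u ᵥ* veroneseMatrix W = 0) (c : Fin m → K) :
    ∃ x, P *ᵥ x = u * W *ᵥ c := by
  classical
  refine (hPW.exact_mulVecLin_vecMulLinear _).1 (dotProduct_eq_zero _ fun c' => ?_)
  exact (dotProduct_mulVec _ W c').symm.trans (sum_mul_mulVec_mul_mulVec hu c c')

end GeneralPosition

section ExtendForm

open Matrix exteriorPower
open Set.powersetCard (ofFinEmbEquiv)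

theorem alternatingMap_eq_sum_minors {R V N I : Type*} [CommRing R] [AddCommGroup V] [Module R V]
    [AddCommGroup N] [Module R N] [Fintype I] [LinearOrder I] {q : ℕ} (b : Module.Basis I R V)
    (φ : V [⋀^Fin q]→ₗ[R] N) (v : Fin q → V) :
    φ v = ∑ s : Set.powersetCard I q,
      (of fun i l => b.repr (v i) (ofFinEmbEquiv.symm s l)).det • φ (b ∘ ofFinEmbEquiv.symm s) := by
  conv_lhs => rw [← alternatingMapLinearEquiv_apply_ιMulti φ v,
    ← (b.exteriorPower q).sum_repr (ιMulti R q v), map_sum]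
  refine Finset.sum_congr rfl fun s _ => ?_
  rw [map_smul, basis_repr_apply, ιMultiDual_apply_ιMulti, basis_apply, ιMulti_family,
    alternatingMapLinearEquiv_apply_ιMulti]
  rfl

variable (K A : Type*) [Field K] [CommRing A] [Algebra K A] {n q : ℕ}

/-- Extension of scalars of alternating forms on `K^n`, by the same polynomials in the
coordinates. -/
noncomputable def extendForm :
    ((Fin n → K) [⋀^Fin q]→ₗ[K] K) →ₗ[K] ((Fin n → A) [⋀^Fin q]→ₗ[A] A) where
  toFun φ := ∑ s : Set.powersetCard (Fin n) q,
    algebraMap K A (φ (Pi.basisFun K (Fin n) ∘ ofFinEmbEquiv.symm s)) •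
      detRowAlternating.compLinearMap (LinearMap.funLeft A A (ofFinEmbEquiv.symm s))
  map_add' φ ψ := by
    simp only [AlternatingMap.add_apply, map_add, add_smul, Finset.sum_add_distrib]
  map_smul' c φ := by
    simp only [AlternatingMap.smul_apply, smul_eq_mul, map_mul, mul_smul, RingHom.id_apply,
      Finset.smul_sum]
    exact Finset.sum_congr rfl fun s _ => AlternatingMap.ext fun v => algebraMap_smul A c _

theorem extendForm_algebraMap (φ : (Fin n → K) [⋀^Fin q]→ₗ[K] K) (v : Fin q → Fin n → K) :
    extendForm K A φ (fun i => algebraMap K A ∘ v i) = algebraMap K A (φ v) := by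
  rw [alternatingMap_eq_sum_minors (Pi.basisFun K (Fin n)) φ, map_sum]
  refine (alternatingMap_sum_apply _ _ _).trans (Finset.sum_congr rfl fun s _ => ?_)
  rw [smul_eq_mul, map_mul, mul_comm, RingHom.map_det]
  rfl

variable {K A}

theorem extendForm_eq {φ : (Fin n → K) [⋀^Fin q]→ₗ[K] K} {ψ : (Fin n → A) [⋀^Fin q]→ₗ[A] A}
    (h : ∀ v : Fin q → Fin n → K, ψ (fun i => algebraMap K A ∘ v i) = algebraMap K A (φ v)) :
    extendForm K A φ = ψ := by
  refine Module.Basis.ext_alternating (Pi.basisFun A (Fin n)) fun κ _ => ?_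
  have hκ : (fun i => Pi.basisFun A (Fin n) (κ i))
      = fun i => algebraMap K A ∘ Pi.basisFun K (Fin n) (κ i) := by
    funext i l
    simp [Pi.single_apply, apply_ite (algebraMap K A)]
  rw [hκ, h, extendForm_algebraMap]

theorem extendForm_koszul (p : Fin n → K) (φ : (Fin n → K) [⋀^Fin q]→ₗ[K] K) :
    extendForm K A (koszul (dotProductBilin K K p) q φ)
      = koszul (dotProductBilin A A (algebraMap K A ∘ p)) q (extendForm K A φ) := by
  refine extendForm_eq fun v => ?_
  rw [koszul_apply, koszul_apply, map_sum]
  refine Finset.sum_congr rfl fun i _ => ?_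
  have h := extendForm_algebraMap K A φ (i.removeNth v)
  simp only [map_zsmul, smul_eq_mul, map_mul, ← h]
  congr 2
  exact (RingHom.map_dotProduct (algebraMap K A) p (v i)).symm

theorem extendForm_det (P : Matrix (Fin q) (Fin n) K) :
    extendForm K A (detRowAlternating.compLinearMap P.mulVecLin)
      = detRowAlternating.compLinearMap (P.map (algebraMap K A)).mulVecLin := by
  refine extendForm_eq fun v => ?_
  refine Eq.trans ?_ (RingHom.map_det (algebraMap K A) _).symm
  refine congrArg det (Matrix.ext fun i l => ?_)
  exact (RingHom.map_dotProduct (algebraMap K A) (P l) (v i)).symm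

end ExtendForm

section GaleFunctional

open Matrix

variable {K A Γ : Type*} [Field K] [CommRing A] [Algebra K A] [Fintype Γ] {n s : ℕ}

/-- The functional on the cochains of degree `s` with values in `Γ → K` that evaluates their
components on `s` of the `s + 1` columns of `a` and pairs the result with the remaining column
of `W`. -/
noncomputable def galeFunctional (W : Matrix Γ (Fin (s + 1)) K)
    (a : Matrix (Fin n) (Fin (s + 1)) A) :
    ((Fin n → K) [⋀^Fin s]→ₗ[K] (Γ → K)) →ₗ[K] A where
  toFun e := ∑ j, ∑ l : Fin (s + 1), (-1) ^ (l : ℕ) • (algebraMap K A (W j l) *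
    extendForm K A ((LinearMap.proj j).compAlternatingMap e) (l.removeNth a.col))
  map_add' e e' := by
    simp only [LinearMap.compAlternatingMap_add, map_add, AlternatingMap.add_apply, mul_add,
      smul_add, Finset.sum_add_distrib]
  map_smul' c e := by
    simp only [LinearMap.compAlternatingMap_smul, map_smul, AlternatingMap.smul_apply,
      RingHom.id_apply, Finset.smul_sum, mul_smul_comm, smul_comm c]

theorem galeFunctional_apply (W : Matrix Γ (Fin (s + 1)) K) (a : Matrix (Fin n) (Fin (s + 1)) A)
    (e : (Fin n → K) [⋀^Fin s]→ₗ[K] (Γ → K)) :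
    galeFunctional W a e = ∑ j, ∑ l : Fin (s + 1), (-1) ^ (l : ℕ) • (algebraMap K A (W j l) *
      extendForm K A ((LinearMap.proj j).compAlternatingMap e) (l.removeNth a.col)) :=
  rfl

theorem galeFunctional_eq_sum_koszul (W : Matrix Γ (Fin (s + 1)) K)
    (a : Matrix (Fin n) (Fin (s + 1)) A) (e : (Fin n → K) [⋀^Fin s]→ₗ[K] (Γ → K)) :
    galeFunctional W a e = ∑ j, koszul (dotProductBilin A A (algebraMap K A ∘ W j)) s
      ((extendForm K A ((LinearMap.proj j).compAlternatingMap e)).compLinearMap a.mulVecLin)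
        fun l => Pi.single l 1 := by
  refine Finset.sum_congr rfl fun j _ => ?_
  rw [koszul_apply]
  refine Finset.sum_congr rfl fun l _ => ?_
  rw [AlternatingMap.compLinearMap_apply, smul_eq_mul]
  congr 2
  · simp
  · congr 1
    funext i
    exact (mulVec_single_one a _).symm

theorem galeFunctional_eq_zero_of_vecMul_eq_zero {W : Matrix Γ (Fin (s + 1)) K}
    (a : Matrix (Fin n) (Fin (s + 1)) A) {e : (Fin n → K) [⋀^Fin s]→ₗ[K] (Γ → K)}
    (he : ∀ v, e v ᵥ* W = 0) : galeFunctional W a e = 0 := by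
  have hW (l) : ∑ j, W j l • (LinearMap.proj (R := K) (φ := fun _ : Γ => K) j).compAlternatingMap e
      = 0 := by
    ext v
    simpa [vecMul, dotProduct, mul_comm, alternatingMap_sum_apply] using congrFun (he v) l
  rw [galeFunctional_apply, Finset.sum_comm]
  refine Finset.sum_eq_zero fun l _ => ?_
  have hextend := DFunLike.congr_fun (congrArg (extendForm K A) (hW l)) (l.removeNth a.col)
  rw [map_sum, map_zero, alternatingMap_sum_apply] at hextend
  simp only [map_smul, AlternatingMap.smul_apply, Algebra.smul_def,
    AlternatingMap.zero_apply] at hextend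
  rw [← Finset.smul_sum, hextend, smul_zero]

theorem galeFunctional_eq_zero_of_mem_koszulCoboundaries {P : Matrix Γ (Fin n) K}
    {W : Matrix Γ (Fin (s + 1)) K} {a : Matrix (Fin n) (Fin (s + 1)) A} {u : Γ → A}
    (ha : ∀ j, (algebraMap K A ∘ P j) ᵥ* a = u j • (algebraMap K A ∘ W j))
    {e : (Fin n → K) [⋀^Fin s]→ₗ[K] (Γ → K)} (he : e ∈ koszulCoboundaries P.mulVecLin (Γ → K) s) :
    galeFunctional W a e = 0 := by
  cases s with
  | zero => rw [(Submodule.mem_bot K).1 he, map_zero]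
  | succ q =>
    obtain ⟨g, rfl⟩ := he
    rw [galeFunctional_eq_sum_koszul]
    refine Finset.sum_eq_zero fun j _ => ?_
    have hP : koszul (dotProductBilin K K (P j)) q ((LinearMap.proj j).compAlternatingMap g)
        = (LinearMap.proj j).compAlternatingMap (koszul P.mulVecLin q g) :=
      koszul_compAlternatingMap _ (fun v x => rfl) q g
    have hW : dotProductBilin A A (algebraMap K A ∘ P j) ∘ₗ a.mulVecLin
        = u j • dotProductBilin A A (algebraMap K A ∘ W j) := by
      refine LinearMap.ext fun x => ?_
      exact (dotProduct_mulVec _ a x).trans ((congrArg (· ⬝ᵥ x) (ha j)).trans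
        (smul_dotProduct _ _ _))
    rw [← hP, extendForm_koszul, ← koszul_compLinearMap, hW, koszul_smul, map_smul, koszul_koszul,
      smul_zero, AlternatingMap.zero_apply]

theorem galeFunctional_single_det [DecidableEq Γ] {P : Matrix Γ (Fin n) K}
    {W : Matrix Γ (Fin (s + 1)) K} {a : Matrix (Fin n) (Fin (s + 1)) A} {u : Γ → A}
    (ha : ∀ j, (algebraMap K A ∘ P j) ᵥ* a = u j • (algebraMap K A ∘ W j))
    (j₀ : Γ) (ι : Fin s → Γ) :
    galeFunctional W a ((LinearMap.single K (fun _ => K) j₀).compAlternatingMap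
        (detRowAlternating.compLinearMap (P.submatrix ι id).mulVecLin))
      = algebraMap K A (W.submatrix (Fin.cons j₀ ι) id).det * ∏ b, u (ι b) := by
  have hproj (j : Γ) : (LinearMap.proj j).compAlternatingMap
      ((LinearMap.single K (fun _ => K) j₀).compAlternatingMap
        (detRowAlternating.compLinearMap (P.submatrix ι id).mulVecLin))
      = (if j = j₀ then 1 else 0 : K) •
        detRowAlternating.compLinearMap (P.submatrix ι id).mulVecLin := by
    ext v
    rw [AlternatingMap.smul_apply]
    simp [Pi.single_apply]
  have hdet (l : Fin (s + 1)) : detRowAlternating.compLinearMap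
      ((P.submatrix ι id).map (algebraMap K A)).mulVecLin (l.removeNth a.col)
      = (∏ b, u (ι b)) * algebraMap K A (W.submatrix ι l.succAbove).det := by
    rw [← det_transpose, RingHom.map_det, ← det_mul_row]
    refine congrArg det (Matrix.ext fun i b => ?_)
    exact congrFun (ha (ι b)) (l.succAbove i)
  rw [galeFunctional_apply, Finset.sum_eq_single j₀
    (fun j _ hj => by simp [hproj, hj]) (by simp), det_succ_row_zero, map_sum, Finset.sum_mul]
  refine Finset.sum_congr rfl fun l _ => ?_
  rw [hproj, if_pos rfl, one_smul, extendForm_det, hdet]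
  have hminor : (W.submatrix (Fin.cons j₀ ι) id).submatrix Fin.succ l.succAbove
      = W.submatrix ι l.succAbove := rfl
  simp only [hminor, map_mul, map_pow, map_neg, map_one, zsmul_eq_mul, Int.cast_pow, Int.cast_neg,
    Int.cast_one, submatrix_apply, Fin.cons_zero, id]
  ring

end GaleFunctional

section Existence

open Matrix MvPolynomial

variable {K Γ : Type*} [Field K] {y q : ℕ}

theorem homogeneousSubmodule_le_span_prod_linForm {Y : Γ → Fin y → K}
    (hY : ∀ J : Set Γ, J.encard < q → Submodule.span K (Y '' Jᶜ) = ⊤) :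
    homogeneousSubmodule (Fin y) K q ≤
      Submodule.span K (Set.range fun ι : Fin q ↪ Γ => ∏ b, linForm K y (Y (ι b))) := by
  induction q with
  | zero =>
    rw [homogeneousSubmodule_zero, Submodule.one_eq_span, Submodule.span_singleton_le_iff_mem]
    exact Submodule.subset_span ⟨Function.Embedding.ofIsEmpty, Finset.prod_empty⟩
  | succ q ih =>
    have hstep (ι : Fin q ↪ Γ) : homogeneousSubmodule (Fin y) K 1 ≤
        (Submodule.span K (Set.range fun ι : Fin (q + 1) ↪ Γ =>
          ∏ b, linForm K y (Y (ι b)))).comap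
            (LinearMap.mulLeft K (∏ b, linForm K y (Y (ι b)))) := by
      have hcard : (Set.range ι).encard < (q + 1 : ℕ) := by
        rw [← Set.image_univ, ι.injective.encard_image, Set.encard_univ,
          ENat.card_eq_coe_fintype_card, Fintype.card_fin]
        exact_mod_cast q.lt_succ_self
      rw [← range_linForm, LinearMap.range_eq_map, ← hY _ hcard, Submodule.map_span_le]
      rintro _ ⟨j, hj, rfl⟩
      exact Submodule.subset_span ⟨Fin.Embedding.snoc ι hj, by simp [Fin.prod_univ_castSucc]⟩
    rw [← homogeneousSubmodule_one_pow, pow_succ, homogeneousSubmodule_one_pow, Submodule.mul_le]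
    intro f hf g hg
    have hle : homogeneousSubmodule (Fin y) K q ≤ Submodule.comap (LinearMap.mulRight K g) _ :=
      (ih fun J hJ => hY J (hJ.trans (by exact_mod_cast q.lt_succ_self))).trans
        (Submodule.span_le.2 (Set.range_subset_iff.2 fun ι => hstep ι hg))
    exact hle hf

theorem IsGaleTransform.exists_vecMul_eq_linForm_smul [Fintype Γ] {n m : ℕ} {P : Matrix Γ (Fin n) K}
    {W : Matrix Γ (Fin m) K} (hPW : IsGaleTransform P W) {Y : Matrix Γ (Fin y) K}
    (hY : ∀ v, (Y *ᵥ v) ᵥ* veroneseMatrix W = 0) :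
    ∃ a : Matrix (Fin n) (Fin m) (MvPolynomial (Fin y) K),
      ∀ j, (algebraMap K _ ∘ P j) ᵥ* a = linForm K y (Y j) • (algebraMap K _ ∘ W j) := by
  have hcol (k l) := hPW.exists_mulVec_eq_mul (hY (Pi.single k 1)) (Pi.single l 1)
  choose x hx using hcol
  refine ⟨of fun i l => linForm K y fun k => x k l i, fun j => funext fun l => ?_⟩
  have hrow : ∑ i, P j i • (fun k => x k l i) = W j l • Y j := by
    funext k
    rw [Finset.sum_apply]
    exact (congrFun (hx k l) j).trans (by simp [mul_comm])
  calc ((algebraMap K _ ∘ P j) ᵥ* of fun i l => linForm K y fun k => x k l i) l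
      = linForm K y (∑ i, P j i • (fun k => x k l i)) := by
        rw [map_sum (linForm K y), vecMul, dotProduct]
        refine Finset.sum_congr rfl fun i _ => ?_
        rw [map_smul, Algebra.smul_def]
        rfl
    _ = linForm K y (Y j) * algebraMap K _ (W j l) := by
        rw [hrow, map_smul, Algebra.smul_def, mul_comm]

theorem LinearlyGeneral.span_image_compl_eq_top [Fintype Γ] {m : ℕ} {W : Matrix Γ (Fin m) K}
    (hW : LinearlyGeneral W) (hm : m ≤ Fintype.card Γ) {Y : Matrix Γ (Fin y) K}
    (hY : Function.Injective Y.mulVec) (hYW : ∀ v, (Y *ᵥ v) ᵥ* veroneseMatrix W = 0)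
    {J : Set Γ} (hJ : J.encard ≤ m) : Submodule.span K (Y '' Jᶜ) = ⊤ := by
  classical
  by_contra hne
  obtain ⟨f, hf, hf0⟩ := Submodule.exists_dual_map_eq_bot_of_lt_top (lt_top_iff_ne_top.2 hne)
    inferInstance
  obtain ⟨d, rfl⟩ := (dotProductEquiv K (Fin y)).surjective f
  have hd (j) (hj : j ∉ J.toFinset) : (Y *ᵥ d) j = 0 := by
    have := Submodule.map_le_iff_le_comap.1 hf0.le
      (Submodule.subset_span ⟨j, by simpa using hj, rfl⟩)
    exact (dotProduct_comm _ _).trans this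
  have hYd := hW.eq_zero_of_vecMul_veroneseMatrix hm (hYW d)
    (J := J.toFinset) (by rwa [Set.encard_eq_coe_toFinset_card, Nat.cast_le] at hJ) hd
  have : d = 0 := hY (hYd.trans (mulVec_zero Y).symm)
  exact hf (by rw [this, map_zero])

theorem LinearlyGeneral.exists_functional [Fintype Γ] {n s : ℕ} {P : Matrix Γ (Fin n) K}
    (hP : LinearlyGeneral P) (hΓ : Fintype.card Γ = n + (s + 1))
    (hy : y + (s + 2).choose 2 ≤ Fintype.card Γ) :
    ∃ Θ : ((Fin n → K) [⋀^Fin s]→ₗ[K] (Γ → K)) →ₗ[K] MvPolynomial (Fin y) K,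
      koszulCoboundaries P.mulVecLin (Γ → K) s ≤ LinearMap.ker Θ ∧
      (∀ e, (∀ v, e v ∈ LinearMap.range P.mulVecLin) → Θ e = 0) ∧
      homogeneousSubmodule (Fin y) K s ≤ LinearMap.range Θ := by
  classical
  obtain ⟨W, hPW⟩ := hP.exists_isGaleTransform hΓ
  have hW := hPW.linearlyGeneral hP hΓ
  obtain ⟨Y, hY, hYW⟩ := exists_matrix_mulVec_mem_ker_veroneseMatrix W hy
  obtain ⟨a, ha⟩ := hPW.exists_vecMul_eq_linForm_smul hYW
  refine ⟨galeFunctional W a, fun e => galeFunctional_eq_zero_of_mem_koszulCoboundaries ha,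
    fun e he => galeFunctional_eq_zero_of_vecMul_eq_zero a fun v =>
      (hPW.exact_mulVecLin_vecMulLinear _).2 (he v), ?_⟩
  refine (homogeneousSubmodule_le_span_prod_linForm fun J hJ =>
    hW.span_image_compl_eq_top (by lia) hY hYW (hJ.le.trans (by simp))).trans ?_
  rw [Submodule.span_le]
  rintro _ ⟨ι, rfl⟩
  obtain ⟨j₀, hj₀⟩ : ∃ j₀, j₀ ∉ Set.range ι := by
    by_contra! h
    have := Fintype.card_le_of_surjective ι h
    rw [Fintype.card_fin] at this
    lia
  have hdet := hW (Fin.Embedding.cons ι hj₀)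
  have hι := galeFunctional_single_det ha j₀ ι
  rw [← Algebra.smul_def] at hι
  exact (Submodule.smul_mem_iff _ hdet).1 ⟨_, hι⟩

end Existence

section Evaluation

open MvPolynomial Matrix

variable {K Γ : Type*} [Field K] {n : ℕ}

/-- The evaluation of polynomials at the points of affine space whose coordinate vectors are the
rows of a matrix. -/
noncomputable def evalPoints (P : Matrix Γ (Fin n) K) : MvPolynomial (Fin n) K →ₐ[K] (Γ → K) :=
  AlgHom.pi fun j => aeval (P j)

theorem evalPoints_apply (P : Matrix Γ (Fin n) K) (F : MvPolynomial (Fin n) K) (j : Γ) :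
    evalPoints P F j = eval (P j) F := by
  simp [evalPoints]

theorem evalPoints_linForm (P : Matrix Γ (Fin n) K) (a : Fin n → K) :
    evalPoints P (linForm K n a) = P *ᵥ a := by
  ext j
  simp [evalPoints_apply, linForm_apply, smul_eval, mulVec, dotProduct, mul_comm]

theorem koszulAcyclic_mulVecLin {P : Matrix Γ (Fin n) K} (hP : ∀ j, ∃ a, (P *ᵥ a) j = 1) (D : ℕ) :
    KoszulAcyclic P.mulVecLin (Γ → K) D :=
  KoszulAcyclic.pi (ℓ' := fun j => LinearMap.proj j ∘ₗ P.mulVecLin) (fun _ _ _ => rfl)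
    fun j => koszulAcyclic_of_apply_eq_one (hP j).choose_spec D

variable [Fintype Γ]

theorem LinearlyGeneral.exists_separating_form {P : Matrix Γ (Fin n) K} (hP : LinearlyGeneral P)
    (hn : n ≤ Fintype.card Γ) (hn' : Fintype.card Γ < 2 * n) [DecidableEq Γ] (d : ℕ) (j₀ : Γ) :
    ∃ F, F.IsHomogeneous (d + 2) ∧ evalPoints P F = Pi.single j₀ 1 := by
  obtain ⟨J, hJ, hJcard⟩ : ∃ J ⊆ Finset.univ.erase j₀, J.card = n - 1 :=
    Finset.exists_subset_card_eq (by simp; lia)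
  obtain ⟨a, ha⟩ := hP.exists_mulVec_eq hn (J := insert j₀ J)
    ((Finset.card_insert_le _ _).trans (by lia)) (Pi.single j₀ 1)
  obtain ⟨b, hb⟩ := hP.exists_mulVec_eq hn (J := Jᶜ) (by rw [Finset.card_compl]; lia)
    (Pi.single j₀ 1)
  refine ⟨linForm K n a ^ (d + 1) * linForm K n b, ?_, ?_⟩
  · simpa using ((isHomogeneous_linForm a).pow (d + 1)).mul (isHomogeneous_linForm b)
  · ext j
    rw [map_mul, map_pow, evalPoints_linForm, evalPoints_linForm, Pi.mul_apply, Pi.pow_apply]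
    by_cases hj : j ∈ J
    · rw [ha j (Finset.mem_insert_of_mem hj), Pi.single_eq_of_ne (Finset.ne_of_mem_erase (hJ hj)),
        zero_pow d.succ_ne_zero, zero_mul]
    · rw [hb j (Finset.mem_compl.2 hj)]
      obtain rfl | hne := eq_or_ne j j₀
      · rw [ha j (Finset.mem_insert_self _ _), Pi.single_eq_same, one_pow, one_mul]
      · rw [Pi.single_eq_of_ne hne, mul_zero]

theorem LinearlyGeneral.map_homogeneousSubmodule_evalPoints {P : Matrix Γ (Fin n) K}
    (hP : LinearlyGeneral P) (hn : n ≤ Fintype.card Γ) (hn' : Fintype.card Γ < 2 * n) (d : ℕ) :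
    (homogeneousSubmodule (Fin n) K (d + 2)).map (evalPoints P).toLinearMap = ⊤ := by
  classical
  rw [eq_top_iff, ← (Pi.basisFun K Γ).span_eq, Submodule.span_le]
  rintro _ ⟨j, rfl⟩
  obtain ⟨F, hF, hFj⟩ := hP.exists_separating_form hn hn' d j
  exact ⟨F, hF, by simpa using hFj⟩

end Evaluation

section Ideal

open MvPolynomial

variable {K : Type u} {Γ : Type*} [Field K] {r γ : ℕ}

/-- The ideal generated by the forms that vanish at the rows of a matrix. These are the
homogeneous coordinate vectors of the points under consideration, so this is `pointsIdeal`
expressed in coordinates. -/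
noncomputable def formsIdeal (P : Matrix Γ (Fin (r + 1)) K) : Ideal (CoordRing K r) :=
  Ideal.span {F | (∃ n, F.IsHomogeneous n) ∧ ∀ j, eval (P j) F = 0}

theorem eval_smul_of_isHomogeneous {σ R : Type*} [CommSemiring R] {n : ℕ} {F : MvPolynomial σ R}
    (hF : F.IsHomogeneous n) (c : R) (x : σ → R) : eval (c • x) F = c ^ n * eval x F := by
  rw [eval_eq, eval_eq, Finset.mul_sum]
  refine Finset.sum_congr rfl fun d hd => ?_
  rw [hF.degree_eq_sum_deg_support hd, ← Finset.prod_pow_eq_pow_sum,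
    mul_left_comm, ← Finset.prod_mul_distrib]
  simp only [Pi.smul_apply, smul_eq_mul, mul_pow]

theorem pointsIdeal_mk (v : Fin γ → Fin (r + 1) → K) (hv : ∀ i, v i ≠ 0) :
    pointsIdeal (fun i => Projectivization.mk K (v i) (hv i)) = formsIdeal (Matrix.of v) := by
  unfold pointsIdeal formsIdeal
  congr 1
  ext F
  refine and_congr_right fun ⟨n, hn⟩ => forall_congr' fun i => ?_
  obtain ⟨a, ha⟩ := Projectivization.exists_smul_eq_mk_rep K (v i) (hv i)
  rw [← ha, Units.smul_def, eval_smul_of_isHomogeneous hn]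
  exact mul_eq_zero_iff_left (pow_ne_zero n a.ne_zero)

theorem evalPoints_eq_zero_of_mem {P : Matrix Γ (Fin (r + 1)) K} {F : CoordRing K r}
    (hF : F ∈ formsIdeal P) : evalPoints P F = 0 := by
  have formsIdeal_le_ker (j) : formsIdeal P ≤ RingHom.ker (eval (P j)) :=
    Ideal.span_le.2 fun G hG => hG.2 j
  ext j
  rw [evalPoints_apply, Pi.zero_apply]
  exact RingHom.mem_ker.1 (formsIdeal_le_ker j hF)

theorem mem_formsIdeal {P : Matrix Γ (Fin (r + 1)) K} {F : CoordRing K r} {n : ℕ}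
    (hF : F.IsHomogeneous n) (hPF : evalPoints P F = 0) : F ∈ formsIdeal P :=
  Ideal.subset_span ⟨⟨n, hF⟩, fun j => by rw [← evalPoints_apply, hPF, Pi.zero_apply]⟩

theorem homogeneousComponent_mem_formsIdeal {P : Matrix Γ (Fin (r + 1)) K} {F : CoordRing K r}
    (hF : F ∈ formsIdeal P) (j : ℕ) : homogeneousComponent j F ∈ formsIdeal P := by
  let := gradedAlgebra (σ := Fin (r + 1)) (R := K)
  exact (mem_iff_homogeneousComponent_mem (Ideal.homogeneous_span _ _ fun _ hG => hG.1) F).1 hF j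

end Ideal

section BettiBound

open MvPolynomial

theorem finrank_homogeneousSubmodule (K : Type*) [Field K] (y s : ℕ) :
    Module.finrank K (homogeneousSubmodule (Fin y) K s) = y.multichoose s := by
  have degree_eq : {d : Fin y →₀ ℕ | d.degree = s} =
      (Finset.finsuppAntidiag Finset.univ s : Finset (Fin y →₀ ℕ)) := by
    ext d
    simp [Finset.mem_finsuppAntidiag, Finsupp.degree_eq_sum]
  rw [homogeneousSubmodule_eq_finsupp_supported, degree_eq]
  refine (AddMonoidAlgebra.supportedEquivFinsupp (R := K) (S := K) _).finrank_eq.trans ?_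
  simp [Finset.card_finsuppAntidiag_nat_eq_multichoose]

variable {K : Type u} {Γ : Type*} [Field K] [Fintype Γ] {r : ℕ}

theorem LinearlyGeneral.multichoose_le_betti {P : Matrix Γ (Fin (r + 1)) K}
    (hP : LinearlyGeneral P) {s i y : ℕ} (hΓ : Fintype.card Γ = r + s + 2) (hi : s + i = r)
    (hi0 : 0 < i) (hy : y + (s + 2).choose 2 ≤ Fintype.card Γ)
    (F : MinimalFreeResolution (formsIdeal P)) : y.multichoose s ≤ F.betti i (i + 2) := by
  obtain ⟨Θ, hΘ_coboundary, hΘ_linear, hΘ_range⟩ := hP.exists_functional (by lia) hy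
  obtain ⟨g, hg⟩ := exists_rightInverse_on_range Θ
  have hacyclic : KoszulAcyclic P.mulVecLin (Γ → K) (s + 1) :=
    koszulAcyclic_mulVecLin (fun j => by
      obtain ⟨a, ha⟩ := hP.exists_mulVec_eq (by lia) (J := {j}) (by simp) 1
      exact ⟨a, ha j (Finset.mem_singleton_self j)⟩) _
  rw [← finrank_homogeneousSubmodule K, show i + 2 = 1 + i + 1 by lia]
  refine finrank_le_betti F (ε := (evalPoints P).toLinearMap) (ℓ := P.mulVecLin)
    (fun _ => evalPoints_eq_zero_of_mem) (fun _ _ => mem_formsIdeal)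
    (fun _ => homogeneousComponent_mem_formsIdeal) (fun a G => ?_) hi (hacyclic s s.lt_succ_self)
    (g ∘ₗ (homogeneousSubmodule (Fin y) K s).subtype) (fun t v => ?_) fun t a ha b hb hab => ?_
  · exact (map_mul (evalPoints P) _ _).trans
      (congrArg (· * evalPoints P G) (evalPoints_linForm P a))
  · have hsurj := hP.map_homogeneousSubmodule_evalPoints (by lia) (by lia) 0
    exact Submodule.eq_top_iff'.1 hsurj _
  · have hΘb : Θ ((evalPoints P).toLinearMap.compAlternatingMap b) = 0 := by
      refine hΘ_linear _ fun v => ?_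
      obtain ⟨c, hc⟩ := (range_linForm (K := K) (r + 1)).ge (hb v)
      refine ⟨c, ?_⟩
      rw [LinearMap.compAlternatingMap_apply, ← hc]
      exact (evalPoints_linForm P c).symm
    have hΘt := congrArg Θ hab
    rw [map_add, hΘ_coboundary ha, hΘb, add_zero] at hΘt
    exact Subtype.ext ((hg t (hΘ_range t.2)).symm.trans hΘt)

end BettiBound

section HilbertFunction

theorem finrank_map_eq_finrank_map {K M N N' : Type*} [Field K] [AddCommGroup M] [Module K M]
    [AddCommGroup N] [Module K N] [AddCommGroup N'] [Module K N'] {p : Submodule K M}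
    {f : M →ₗ[K] N} {g : M →ₗ[K] N'} (h : ∀ x ∈ p, f x = 0 ↔ g x = 0) :
    Module.finrank K (p.map f) = Module.finrank K (p.map g) := by
  rw [← LinearMap.range_domRestrict, ← LinearMap.range_domRestrict]
  have ker_eq : LinearMap.ker (f.domRestrict p) = LinearMap.ker (g.domRestrict p) :=
    Submodule.ext fun x => h x x.2
  exact ((f.domRestrict p).quotKerEquivRange.symm ≪≫ₗ Submodule.quotEquivOfEq _ _ ker_eq ≪≫ₗ
    (g.domRestrict p).quotKerEquivRange).finrank_eq

open MvPolynomial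

variable {K : Type u} {Γ : Type*} [Field K] {r : ℕ} {P : Matrix Γ (Fin (r + 1)) K}

theorem hilbertFn_formsIdeal (P : Matrix Γ (Fin (r + 1)) K) (n : ℕ) :
    hilbertFn (formsIdeal P) n = Module.finrank K
      ((homogeneousSubmodule (Fin (r + 1)) K n).map (evalPoints P).toLinearMap) :=
  finrank_map_eq_finrank_map fun _ hF =>
    Ideal.Quotient.eq_zero_iff_mem.trans ⟨evalPoints_eq_zero_of_mem, mem_formsIdeal hF⟩

theorem hilbertFn_formsIdeal_zero [Nonempty Γ] (P : Matrix Γ (Fin (r + 1)) K) :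
    hilbertFn (formsIdeal P) 0 = 1 := by
  rw [hilbertFn_formsIdeal, homogeneousSubmodule_zero, Submodule.one_eq_span, Submodule.map_span,
    Set.image_singleton]
  exact finrank_span_singleton ((map_one (evalPoints P)).trans_ne one_ne_zero)

variable [Fintype Γ]

theorem LinearlyGeneral.hilbertFn_one (hP : LinearlyGeneral P) (hΓ : r + 1 ≤ Fintype.card Γ) :
    hilbertFn (formsIdeal P) 1 = r + 1 := by
  have evalPoints_comp_linForm :
      (evalPoints P).toLinearMap ∘ₗ linForm K (r + 1) = P.mulVecLin :=
    LinearMap.ext (evalPoints_linForm P)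
  rw [hilbertFn_formsIdeal, ← range_linForm, ← LinearMap.range_comp, evalPoints_comp_linForm,
    LinearMap.finrank_range_of_inj (hP.mulVec_injective hΓ), Module.finrank_fin_fun]

theorem LinearlyGeneral.hilbertFn_add_two (hP : LinearlyGeneral P) (hΓ : r + 1 ≤ Fintype.card Γ)
    (hΓ' : Fintype.card Γ < 2 * (r + 1)) (n : ℕ) :
    hilbertFn (formsIdeal P) (n + 2) = Fintype.card Γ := by
  rw [hilbertFn_formsIdeal, hP.map_homogeneousSubmodule_evalPoints hΓ hΓ', finrank_top,
    Module.finrank_fintype_fun_eq_card]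

end HilbertFunction

section HilbertNumerator

open PowerSeries

theorem coeff_one_sub_X_pow (r k : ℕ) :
    coeff k ((1 - X : ℤ⟦X⟧) ^ r) = (-1) ^ k * (r.choose k : ℤ) := by
  induction r generalizing k with
  | zero => rcases k with _ | k <;> simp [coeff_one]
  | succ r ih =>
    rw [pow_succ, mul_sub, mul_one, map_sub, ih]
    rcases k with _ | k
    · simp
    · rw [coeff_succ_mul_X, ih, Nat.choose_succ_succ]
      push_cast
      ring

theorem coeff_add_two_mul_one_sub_X_pow {H : ℤ⟦X⟧} {a b : ℤ}
    (hH : H * (1 - X) = 1 + C a * X + C b * X ^ 2) (r i : ℕ) :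
    (-1) ^ i * coeff (i + 2) (H * (1 - X) ^ (r + 1))
      = r.choose (i + 2) - a * r.choose (i + 1) + b * r.choose i := by
  have expand : H * (1 - X) ^ (r + 1)
      = (1 - X) ^ r + C a * ((1 - X) ^ r * X) + C b * ((1 - X) ^ r * X ^ 2) := by
    rw [pow_succ', ← mul_assoc, hH]
    ring
  have sign_sq : (-1 : ℤ) ^ i * (-1) ^ i = 1 := by rw [← mul_pow, neg_one_mul, neg_neg, one_pow]
  rw [expand, map_add, map_add, coeff_C_mul, coeff_C_mul, coeff_mul_X_pow, coeff_succ_mul_X,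
    coeff_one_sub_X_pow, coeff_one_sub_X_pow, coeff_one_sub_X_pow, pow_succ, pow_succ]
  linear_combination ((r.choose (i + 2) : ℤ) - a * r.choose (i + 1) + b * r.choose i) * sign_sq

variable {K : Type u} {Γ : Type*} [Field K] [Fintype Γ] {r : ℕ} {P : Matrix Γ (Fin (r + 1)) K}

theorem LinearlyGeneral.mk_hilbertFn_mul_one_sub_X (hP : LinearlyGeneral P)
    (hΓ : r + 1 ≤ Fintype.card Γ) (hΓ' : Fintype.card Γ < 2 * (r + 1)) :
    (mk fun n => (hilbertFn (formsIdeal P) n : ℤ)) * (1 - X)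
      = 1 + C (r : ℤ) * X + C (Fintype.card Γ - r - 1 : ℤ) * X ^ 2 := by
  have : Nonempty Γ := Fintype.card_pos_iff.1 (by lia)
  ext n
  rw [mul_sub, mul_one, map_sub, coeff_mk, map_add, map_add, coeff_C_mul, coeff_C_mul, coeff_one,
    coeff_X, coeff_X_pow]
  obtain _ | _ | _ | n := n
  · simp [hilbertFn_formsIdeal_zero]
  · simp [coeff_succ_mul_X, hP.hilbertFn_one hΓ, hilbertFn_formsIdeal_zero]
  · simp [coeff_succ_mul_X, hP.hilbertFn_one hΓ, hP.hilbertFn_add_two hΓ hΓ' 0, sub_sub]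
  · simp [coeff_succ_mul_X, hP.hilbertFn_add_two hΓ hΓ']

theorem LinearlyGeneral.hilbertNumerator_add_two (hP : LinearlyGeneral P)
    (hΓ : r + 1 ≤ Fintype.card Γ) (hΓ' : Fintype.card Γ < 2 * (r + 1)) (i : ℕ) :
    (-1) ^ i * hilbertNumerator (formsIdeal P) (i + 2)
      = r.choose (i + 2) - r * r.choose (i + 1) + (Fintype.card Γ - r - 1) * r.choose i :=
  coeff_add_two_mul_one_sub_X_pow (hP.mk_hilbertFn_mul_one_sub_X hΓ hΓ') r i

end HilbertNumerator

section Criterion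

open MvPolynomial

/-- The product of all maximal minors of the generic matrix with `γ` rows and `n` columns. It
cuts out the complement of the open set of points in linearly general position. -/
noncomputable def minorsProduct (k : Type*) [Field k] (γ n : ℕ) :
    MvPolynomial (Fin γ × Fin n) k :=
  ∏ ι : Fin n ↪ Fin γ, ((Matrix.mvPolynomialX (Fin γ) (Fin n) k).submatrix ι id).det

theorem minorsProduct_ne_zero (k : Type*) [Field k] (γ n : ℕ) : minorsProduct k γ n ≠ 0 := by
  refine Finset.prod_ne_zero_iff.2 fun ι _ => ?_
  have minor_eq_rename : ((Matrix.mvPolynomialX (Fin γ) (Fin n) k).submatrix ι id).det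
      = rename (Prod.map ι id) (Matrix.mvPolynomialX (Fin n) (Fin n) k).det := by
    rw [AlgHom.map_det]
    congr 1
    ext1 b c
    simp
  rw [minor_eq_rename]
  exact (map_ne_zero_iff _ (rename_injective _ (ι.injective.prodMap Function.injective_id))).2
    (Matrix.det_mvPolynomialX_ne_zero _ _)

theorem linearlyGeneral_of_aeval_minorsProduct_ne_zero {k K : Type*} [Field k] [Field K]
    [Algebra k K] {γ n : ℕ} {v : Fin γ → Fin n → K}
    (hv : aeval (fun x : Fin γ × Fin n => v x.1 x.2) (minorsProduct k γ n) ≠ 0) :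
    LinearlyGeneral (Matrix.of v) := by
  intro ι
  rw [minorsProduct, map_prod, Finset.prod_ne_zero_iff] at hv
  convert hv ι (Finset.mem_univ ι) using 1
  rw [AlgHom.map_det]
  congr 1
  ext b c
  simp

theorem expectedBetti_add_two_le {K : Type u} [Field K] {r i : ℕ} (I : Ideal (CoordRing K r))
    (hi : 0 < i) :
    expectedBetti I i (i + 2) ≤ max ((-1) ^ i * hilbertNumerator I (i + 2)) 0 := by
  rw [expectedBetti, if_neg hi.ne']
  split_ifs
  · exact le_rfl
  · exact le_max_right _ _

theorem mrcFails_of_expected_lt_multichoose (k : Type u) [Field k] {r s i y : ℕ} (hi : s + i = r)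
    (hi0 : 0 < i) (hy : y + (s + 2).choose 2 ≤ r + s + 2)
    (hlt : max ((r.choose (i + 2) : ℤ) - r * r.choose (i + 1) + (s + 1) * r.choose i) 0
      < y.multichoose s) : MRCFails k r (r + s + 2) := by
  refine ⟨minorsProduct k (r + s + 2) (r + 1), minorsProduct_ne_zero _ _ _, ?_⟩
  intro K _ _ v hv0 hv
  have hP : LinearlyGeneral (Matrix.of v) := linearlyGeneral_of_aeval_minorsProduct_ne_zero hv
  have hcard := Fintype.card_fin (r + s + 2)
  rw [SatisfiesMRC, pointsIdeal_mk]
  rintro ⟨F, hF⟩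
  have lower_bound : (y.multichoose s : ℤ) ≤ F.betti i (i + 2) :=
    mod_cast hP.multichoose_le_betti hcard hi hi0 (hy.trans hcard.ge) F
  have numerator := hP.hilbertNumerator_add_two (by lia) (by lia) i
  rw [hcard, show ((r + s + 2 : ℕ) : ℤ) - r - 1 = s + 1 by push_cast; ring] at numerator
  have expected := expectedBetti_add_two_le (formsIdeal (Matrix.of v)) hi0
  rw [numerator, ← hF i (i + 2)] at expected
  exact (expected.trans_lt hlt).not_ge lower_bound

theorem choose_sub_mul_choose_add_mul_choose_nonpos {r s i : ℕ} (hi : s + i = r)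
    (hs : r + 2 ≤ s ^ 2) :
    (r.choose (i + 2) : ℤ) - r * r.choose (i + 1) + (s + 1) * r.choose i ≤ 0 := by
  have choose_succ : (r.choose (i + 1) : ℤ) * (i + 1) = r.choose i * s := by
    have := Nat.choose_succ_right_eq r i
    rw [show r - i = s by lia] at this
    exact_mod_cast this
  have choose_add_two : (r.choose (i + 2) : ℤ) * (i + 2) = r.choose (i + 1) * (s - 1) := by
    have := Nat.choose_succ_right_eq r (i + 1)
    rw [show r - (i + 1) = s - 1 by lia] at this
    rw [← Nat.cast_pred (by nlinarith)]
    exact_mod_cast this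
  have hr : (r : ℤ) = s + i := mod_cast hi.symm
  have factored : ((r.choose (i + 2) : ℤ) - r * r.choose (i + 1) + (s + 1) * r.choose i)
      * ((i + 2) * (i + 1)) = -(r.choose i * (s ^ 2 - (r + 2)) * (i + 1)) := by
    rw [hr] at *
    linear_combination (i + 1 : ℤ) * choose_add_two
      + ((s : ℤ) - 1 - (s + i) * (i + 2)) * choose_succ
  have hs' : (0 : ℤ) ≤ s ^ 2 - (r + 2) := sub_nonneg.2 (mod_cast hs)
  refine nonpos_of_mul_nonpos_left (factored.trans_le (neg_nonpos.2 ?_)) (by positivity)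
  positivity

theorem mrcFails_of_le_sq (k : Type u) [Field k] {r s : ℕ} (hr : r + 2 ≤ s ^ 2)
    (hs : s * (s + 1) ≤ 2 * r) : MRCFails k r (r + s + 2) := by
  have hsr : s < r := by nlinarith
  refine mrcFails_of_expected_lt_multichoose k (i := r - s) (y := 1) (by lia) (by lia) ?_ ?_
  · have choose_le : (s + 2).choose 2 ≤ r + s + 1 := by
      rw [Nat.choose_two_right]
      exact Nat.div_le_of_le_mul (by rw [Nat.add_succ_sub_one]; nlinarith)
    lia
  · rw [max_eq_right (choose_sub_mul_choose_add_mul_choose_nonpos (by lia) hr)]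
    simp

end Criterion

section Counting

theorem ncard_natCast_mem_Icc_bounds {a b : ℝ} (ha : 0 ≤ a) (hb : 0 ≤ b) :
    (Set.ncard {n : ℕ | a ≤ n ∧ (n : ℝ) ≤ b} : ℝ) ≤ max 0 (b - a + 1) ∧
      b - a - 1 < Set.ncard {n : ℕ | a ≤ n ∧ (n : ℝ) ≤ b} := by
  have eq_Icc : {n : ℕ | a ≤ n ∧ (n : ℝ) ≤ b} = Finset.Icc ⌈a⌉₊ ⌊b⌋₊ := by
    ext n
    simp [Nat.ceil_le, Nat.le_floor_iff hb]
  have hceil := Nat.ceil_lt_add_one ha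
  have hceil' := Nat.le_ceil a
  have hfloor := Nat.lt_floor_add_one b
  have hfloor' := Nat.floor_le hb
  rw [eq_Icc, Set.ncard_coe_finset, Nat.card_Icc]
  rcases le_total ⌈a⌉₊ (⌊b⌋₊ + 1) with h | h
  · rw [Nat.cast_sub h]
    push_cast
    exact ⟨le_max_of_le_right (by linarith), by linarith⟩
  · rw [Nat.sub_eq_zero_of_le h, Nat.cast_zero]
    have hcast : (⌊b⌋₊ : ℝ) + 1 ≤ ⌈a⌉₊ := mod_cast h
    exact ⟨le_max_left _ _, by linarith⟩

theorem two_mul_sqrt_two_mul_sqrt_le {x : ℝ} (hx : 0 ≤ x) : 2 * (√2 * √x) ≤ √(8 * x + 1) := by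
  refine Real.le_sqrt_of_sq_le ?_
  rw [mul_pow, mul_pow, Real.sq_sqrt hx, Real.sq_sqrt zero_le_two]
  linarith

theorem sqrt_eight_mul_add_one_le {x : ℝ} (hx : 0 ≤ x) : √(8 * x + 1) ≤ 2 * (√2 * √x) + 1 := by
  have expand : (2 * (√2 * √x) + 1) ^ 2 = 4 * (√2 ^ 2 * √x ^ 2) + 4 * (√2 * √x) + 1 := by ring
  rw [Real.sqrt_le_left (by positivity), expand, Real.sq_sqrt hx, Real.sq_sqrt zero_le_two]
  have : 0 ≤ √2 * √x := by positivity
  linarith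

theorem sqrt_add_two_le {x : ℝ} (hx : 2 ≤ √x) : √(x + 2) ≤ √x + 1 / 2 := by
  have hx_sq : √x ^ 2 = x := Real.sq_sqrt (Real.sqrt_pos.1 (two_pos.trans_le hx)).le
  rw [Real.sqrt_le_left (by linarith)]
  nlinarith

theorem abs_ncard_sub_lt_two (r : ℕ) :
    |(Set.ncard {γ : ℕ | (r : ℝ) + 2 + √((r : ℝ) + 2) ≤ (γ : ℝ) ∧
          (γ : ℝ) ≤ (r : ℝ) + (3 + √(8 * (r : ℝ) + 1)) / 2} : ℝ)
        - (√2 - 1) * √(r : ℝ)| < 2 := by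
  have hr : (0 : ℝ) ≤ r := r.cast_nonneg
  obtain ⟨ncard_le, lt_ncard⟩ := ncard_natCast_mem_Icc_bounds
    (a := (r : ℝ) + 2 + √((r : ℝ) + 2)) (b := (r : ℝ) + (3 + √(8 * (r : ℝ) + 1)) / 2)
    (by positivity) (by positivity)
  have sqrt_mono : √(r : ℝ) ≤ √((r : ℝ) + 2) := Real.sqrt_le_sqrt (by linarith)
  have sqrt_le := sqrt_eight_mul_add_one_le hr
  have le_sqrt := two_mul_sqrt_two_mul_sqrt_le hr
  have main_nonneg : 0 ≤ (√2 - 1) * √(r : ℝ) :=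
    mul_nonneg (sub_nonneg.2 Real.one_lt_sqrt_two.le) (Real.sqrt_nonneg _)
  rw [abs_lt, neg_lt_sub_iff_lt_add, sub_lt_iff_lt_add]
  constructor
  · rcases le_total 2 √(r : ℝ) with h | h
    · have := sqrt_add_two_le h
      linarith
    · have ncard_nonneg : (0 : ℝ) ≤ Set.ncard {γ : ℕ | (r : ℝ) + 2 + √((r : ℝ) + 2) ≤ (γ : ℝ) ∧
          (γ : ℝ) ≤ (r : ℝ) + (3 + √(8 * (r : ℝ) + 1)) / 2} := Nat.cast_nonneg _
      have main_le : (√2 - 1) * √(r : ℝ) ≤ (√2 - 1) * 2 :=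
        mul_le_mul_of_nonneg_left h (sub_nonneg.2 Real.one_lt_sqrt_two.le)
      linarith [ncard_nonneg, Real.sqrt_two_lt_three_halves]
  · exact ncard_le.trans_lt (max_lt (by linarith) (by linarith))

end Counting

theorem mrcFails_of_mem_range (k : Type u) [Field k] {r γ : ℕ}
    (h : (r : ℝ) + 2 + √((r : ℝ) + 2) ≤ γ) (h' : (γ : ℝ) ≤ r + (3 + √(8 * (r : ℝ) + 1)) / 2) :
    MRCFails k r γ := by
  have hγ : r + 2 ≤ γ := by
    have := Real.sqrt_nonneg ((r : ℝ) + 2)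
    exact_mod_cast (by linarith : (r : ℝ) + 2 ≤ γ)
  obtain ⟨s, rfl⟩ := Nat.exists_eq_add_of_le hγ
  rw [add_right_comm]
  push_cast at h h'
  refine mrcFails_of_le_sq k ?_ ?_
  · have sqrt_le : √((r : ℝ) + 2) ≤ s := by linarith
    rw [Real.sqrt_le_left s.cast_nonneg] at sqrt_le
    exact_mod_cast sqrt_le
  · have le_sqrt : 2 * (s : ℝ) + 1 ≤ √(8 * (r : ℝ) + 1) := by linarith
    rw [Real.le_sqrt (by positivity) (by positivity)] at le_sqrt
    exact_mod_cast (by nlinarith : (s : ℝ) * (s + 1) ≤ 2 * r)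

end PointsMRC

theorem theorem1p1 (k : Type u) [Field k] :
    (∀ r γ : ℕ, 6 ≤ r → r ≠ 9 →
      (r : ℝ) + 2 + √((r : ℝ) + 2) ≤ (γ : ℝ) →
      (γ : ℝ) ≤ (r : ℝ) + (3 + √(8 * (r : ℝ) + 1)) / 2 →
      PointsMRC.MRCFails k r γ) ∧
    PointsMRC.MRCFails k 8 13 ∧
    PointsMRC.MRCFails k 15 21 ∧
    (∀ r : ℕ, 6 ≤ r → r ≠ 9 →
      |(Set.ncard {γ : ℕ | (r : ℝ) + 2 + √((r : ℝ) + 2) ≤ (γ : ℝ) ∧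
          (γ : ℝ) ≤ (r : ℝ) + (3 + √(8 * (r : ℝ) + 1)) / 2} : ℝ)
        - (√2 - 1) * √(r : ℝ)| < 2) := by
  refine ⟨fun r γ _ _ h h' => PointsMRC.mrcFails_of_mem_range k h h', ?_, ?_,
    fun r _ _ => PointsMRC.abs_ncard_sub_lt_two r⟩
  · refine PointsMRC.mrcFails_of_expected_lt_multichoose k (s := 3) (i := 5) (y := 3)
      ?_ ?_ ?_ ?_ <;> norm_num [Nat.choose, Nat.multichoose]
  · refine PointsMRC.mrcFails_of_expected_lt_multichoose k (s := 4) (i := 11) (y := 6)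
      ?_ ?_ ?_ ?_ <;> norm_num [Nat.choose, Nat.multichoose]
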